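/- Let $d\ge 0$ be an integer and let $(X_t)_{t\ge 0}$ be a Lévy process on a probability space $(\Omega,\mathscr A,\mathbb P)$ with values in $\mathbb R^d$, i.e. $X_0=0$ a.s., $X_t-X_s\sim X_{t-s}-X_0$ and $X_t-X_s$ is independent of $\sigma(X_r,\ r\le s)$ for all $0\le s\le t$, and $\lim_{t\to0}\mathbb P(|X_t-X_0|>\epsilon)=0$ for all $\epsilon>0$. Let $P_tf(x)=\mathbb E f(X_t+x)$, let $\mathcal C_\infty(\mathbb R^d)$ be the space of continuous real functions on $\mathbb R^d$ vanishing at infinity, and let $(A,\mathcal D(A))$ be the infinitesimal generator of $(P_t)_{t\ge0}$ on $\mathcal C_\infty(\mathbb R^d)$: $f\in\mathcal D(A)$ and $Af=g$ if, and only if, $f,g\in\mathcal C_\infty(\mathbb R^d)$ and $\lim_{t\downarrow0}\big\|\tfrac{P_tf-f}{t}-g\big\|_\infty=0$. A Lévy triplet $(l,Q,\nu)$ consists of a vector $l\in\mathbb R^d$, a symmetric positive semidefinite matrix $Q\in\mathbb R^{d\times d}$ and a measure $\nu$ on $\mathbb R^d\setminus\{0\}$ such that $\int_{y\ne0}\min\{1,|y|^2\}\,\nu(dy)<\infty$.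 Then there is a continuous function $\psi:\mathbb R^d\to\mathbb C$, the characteristic exponent of $X$, with $\mathbb E\,e^{i\xi\cdot X_t}=e^{-t\psi(\xi)}$ for all $t\ge0$, $\xi\in\mathbb R^d$; one has $\mathcal C_c^\infty(\mathbb R^d)\subset\mathcal D(A)$; and there is a Lévy triplet $(l,Q,\nu)$ such that the following assertions hold, all integrals being absolutely convergent. (a) For all $f\in\mathcal C_c^\infty(\mathbb R^d)$ and $x\in\mathbb R^d$, $$Af(x)=l\cdot\nabla f(x)+\tfrac12\nabla\cdot Q\nabla f(x)+\int_{y\neq0}\big[f(x+y)-f(x)-\nabla f(x)\cdot y\,\mathbf 1_{(0,1)}(|y|)\big]\,\nu(dy).$$ (b) $A$ is a pseudo differential operator with symbol $-\psi$: for all $u\in\mathcal C_c^\infty(\mathbb R^d)$ and $x\in\mathbb R^d$, $$Au(x)=-\psi(D)u(x)=-\int_{\mathbb R^d}\widehat u(\xi)\,\psi(\xi)\,e^{i x\cdot\xi}\,d\xi,\qquad \widehat u(\xi)=(2\pi)^{-d}\int_{\mathbb R^d}u(x)\,e^{-i\xi\cdot x}\,dx.$$ (c) The characteristic exponent is given by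 the Lévy–Khintchine formula: for all $\xi\in\mathbb R^d$, $$\psi(\xi)=-i\,l\cdot\xi+\tfrac12\,\xi\cdot Q\xi+\int_{y\neq0}\Big(1-e^{i y\cdot\xi}+i\,\xi\cdot y\,\mathbf 1_{(0,1)}(|y|)\Big)\,\nu(dy).$$ Moreover, the two descriptions of $A$ are equivalent: a Lévy triplet $(l,Q,\nu)$ satisfies the formula in (a) for all $f\in\mathcal C_c^\infty(\mathbb R^d)$ and $x\in\mathbb R^d$ if, and only if, it satisfies the formula in (c) for all $\xi\in\mathbb R^d$. -/

import Mathlib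

open MeasureTheory ProbabilityTheory Filter
open scoped NNReal ContDiff ZeroAtInfty Matrix Topology

namespace LevyGen

/-- The Euclidean space `ℝ^d`. -/
abbrev E (d : ℕ) : Type := EuclideanSpace ℝ (Fin d)

/-- A Lévy process on `ℝ^d`: a family of random variables `X t`, `t ≥ 0`, which starts at zero almost
surely, has stationary increments, has increments independent of the past `σ(X r, r ≤ s)`, and is
continuous in probability at time zero. -/
structure IsLevyProcess {Ω : Type*} [MeasurableSpace Ω] {d : ℕ}
    (X : ℝ≥0 → Ω → E d) (P : Measure Ω) : Prop where
  measurable : ∀ t, Measurable (X t)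
  start_zero : ∀ᵐ w ∂P, X 0 w = 0
  stationary : ∀ s t : ℝ≥0, s ≤ t →
    IdentDistrib (fun w => X t w - X s w) (fun w => X (t - s) w - X 0 w) P P
  indep : ∀ s t : ℝ≥0, s ≤ t →
    Indep (MeasurableSpace.comap (fun w => X t w - X s w) inferInstance)
      (⨆ (r : ℝ≥0) (_ : r ≤ s), MeasurableSpace.comap (X r) inferInstance) P
  cont_prob : ∀ ε : ℝ, 0 < ε →
    Tendsto (fun t : ℝ≥0 => P {w | ε < ‖X t w - X 0 w‖}) (𝓝[>] 0) (𝓝 0)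

/-- `ψ` is the characteristic exponent of `X`: it is continuous and
`𝔼 exp(i ξ·X_t) = exp(-t ψ(ξ))` for all `t ≥ 0` and `ξ ∈ ℝ^d`. -/
def IsCharacteristicExponent {Ω : Type*} [MeasurableSpace Ω] {d : ℕ}
    (X : ℝ≥0 → Ω → E d) (P : Measure Ω) (ψ : E d → ℂ) : Prop :=
  Continuous ψ ∧ ∀ (t : ℝ≥0) (ξ : E d),
    ∫ w, Complex.exp (Complex.I * (inner ℝ ξ (X t w) : ℝ)) ∂P
      = Complex.exp (-((t : ℝ) : ℂ) * ψ ξ)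

/-- The transition semigroup `P_t f(x) = 𝔼 f(X_t + x)`. -/
noncomputable def semigroup {Ω : Type*} [MeasurableSpace Ω] {d : ℕ}
    (X : ℝ≥0 → Ω → E d) (P : Measure Ω) (t : ℝ≥0) (f : E d → ℝ) (x : E d) : ℝ :=
  ∫ w, f (X t w + x) ∂P

/-- `(P_t f - f) / t → g` in the uniform norm as `t → 0+`. -/
def IsGeneratorLimit {Ω : Type*} [MeasurableSpace Ω] {d : ℕ}
    (X : ℝ≥0 → Ω → E d) (P : Measure Ω) (f g : C₀(E d, ℝ)) : Prop :=
  TendstoUniformly (fun (t : ℝ≥0) (x : E d) => (semigroup X P t f x - f x) / (t : ℝ)) g (𝓝[>] 0)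

/-- The domain `D(A) ⊆ C_∞(ℝ^d)` of the infinitesimal generator. -/
def generatorDomain {Ω : Type*} [MeasurableSpace Ω] {d : ℕ}
    (X : ℝ≥0 → Ω → E d) (P : Measure Ω) : Set C₀(E d, ℝ) :=
  {f | ∃ g : C₀(E d, ℝ), IsGeneratorLimit X P f g}

/-- The infinitesimal generator `A f = lim_{t → 0} (P_t f - f) / t`, `f ∈ D(A)`. -/
noncomputable def generator {Ω : Type*} [MeasurableSpace Ω] {d : ℕ}
    (X : ℝ≥0 → Ω → E d) (P : Measure Ω) (f : generatorDomain X P) : C₀(E d, ℝ) :=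
  Classical.choose f.2

theorem generator_spec {Ω : Type*} [MeasurableSpace Ω] {d : ℕ}
    (X : ℝ≥0 → Ω → E d) (P : Measure Ω) (f : generatorDomain X P) :
    IsGeneratorLimit X P f (generator X P f) :=
  Classical.choose_spec f.2

/-- The limit which defines the generator is unique. -/
theorem generator_eq {Ω : Type*} [MeasurableSpace Ω] {d : ℕ}
    (X : ℝ≥0 → Ω → E d) (P : Measure Ω) (f : generatorDomain X P) (g : C₀(E d, ℝ))
    (hg : IsGeneratorLimit X P f g) : generator X P f = g := by
  ext x
  exact tendsto_nhds_unique ((generator_spec X P f).tendsto_at x) (hg.tendsto_at x)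

/-- Membership in `C_c^∞(ℝ^d)`: smooth with compact support. -/
def IsTest {d : ℕ} (f : E d → ℝ) : Prop :=
  ContDiff ℝ ∞ f ∧ HasCompactSupport f

/-- A Lévy measure, i.e. a measure on `ℝ^d \ {0}` (viewed as a measure on `ℝ^d` without mass at the
origin) which integrates `min {1, |y|^2}`. -/
def IsLevyMeasure {d : ℕ} (ν : Measure (E d)) : Prop :=
  ν {0} = 0 ∧ ∫⁻ y, ENNReal.ofReal (min 1 (‖y‖ ^ 2)) ∂ν < ⊤

/-- A Lévy triplet `(l, Q, ν)`: a vector, a (symmetric) positive semidefinite matrix and a Lévy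
measure. -/
structure IsLevyTriplet {d : ℕ} (l : E d) (Q : Matrix (Fin d) (Fin d) ℝ) (ν : Measure (E d)) :
    Prop where
  posSemidef : Q.PosSemidef
  levyMeasure : IsLevyMeasure ν

/-- The truncation function `y ↦ 𝟙_{(0,1)}(|y|)`. -/
noncomputable def trunc {d : ℕ} (y : E d) : ℝ :=
  Set.indicator (Set.Ioo (0 : ℝ) 1) (fun _ => 1) ‖y‖

/-- The divergence `∇·F = ∑ₖ ∂ₖ Fₖ` of a vector field. -/
noncomputable def divergence {d : ℕ} (F : E d → Fin d → ℝ) (x : E d) : ℝ :=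
  ∑ k, fderiv ℝ (fun z => F z k) x (EuclideanSpace.single k 1)

/-- The jump integrand `f(x+y) - f(x) - ∇f(x)·y 𝟙_{(0,1)}(|y|)`. -/
noncomputable def jumpIntegrand {d : ℕ} (f : E d → ℝ) (x y : E d) : ℝ :=
  f (x + y) - f x - inner ℝ (gradient f x) y * trunc y

/-- The integro-differential operator
`l·∇f(x) + ½ ∇·Q∇f(x) + ∫ [f(x+y) - f(x) - ∇f(x)·y 𝟙_{(0,1)}(|y|)] ν(dy)`. -/
noncomputable def levyOperator {d : ℕ} (l : E d) (Q : Matrix (Fin d) (Fin d) ℝ)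
    (ν : Measure (E d)) (f : E d → ℝ) (x : E d) : ℝ :=
  inner ℝ l (gradient f x)
    + (1 / 2 : ℝ) * divergence (fun z => Q *ᵥ (gradient f z).ofLp) x
    + ∫ y, jumpIntegrand f x y ∂ν

/-- The Fourier transform `û(ξ) = (2π)^{-d} ∫ u(x) exp(-i ξ·x) dx`. -/
noncomputable def fourierHat {d : ℕ} (u : E d → ℝ) (ξ : E d) : ℂ :=
  (((2 * Real.pi) ^ d)⁻¹ : ℝ) *
    ∫ x : E d, (u x : ℂ) * Complex.exp (-(Complex.I * (inner ℝ ξ x : ℝ)))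

/-- The integrand `û(ξ) p(x,ξ) exp(i x·ξ)` of a pseudo differential operator. -/
noncomputable def pdoIntegrand {d : ℕ} (p : E d → E d → ℂ) (u : E d → ℝ) (x ξ : E d) : ℂ :=
  fourierHat u ξ * p x ξ * Complex.exp (Complex.I * (inner ℝ x ξ : ℝ))

/-- The pseudo differential operator `p(x,D) u(x) = ∫ û(ξ) p(x,ξ) exp(i x·ξ) dξ` with symbol `p`. -/
noncomputable def pseudoDiff {d : ℕ} (p : E d → E d → ℂ) (u : E d → ℝ) (x : E d) : ℂ :=
  ∫ ξ : E d, pdoIntegrand p u x ξ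

/-- The integrand `1 - exp(i y·ξ) + i ξ·y 𝟙_{(0,1)}(|y|)` in the Lévy–Khintchine formula. -/
noncomputable def lkIntegrand {d : ℕ} (ξ y : E d) : ℂ :=
  1 - Complex.exp (Complex.I * (inner ℝ y ξ : ℝ))
    + Complex.I * (inner ℝ ξ y : ℝ) * (trunc y : ℝ)

/-- The right-hand side
`-i l·ξ + ½ ξ·Qξ + ∫ (1 - exp(i y·ξ) + i ξ·y 𝟙_{(0,1)}(|y|)) ν(dy)` of the Lévy–Khintchine formula. -/
noncomputable def levyKhintchine {d : ℕ} (l : E d) (Q : Matrix (Fin d) (Fin d) ℝ)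
    (ν : Measure (E d)) (ξ : E d) : ℂ :=
  -(Complex.I * (inner ℝ l ξ : ℝ)) + (1 / 2 : ℂ) * ((ξ.ofLp ⬝ᵥ Q *ᵥ ξ.ofLp : ℝ) : ℂ)
    + ∫ y, lkIntegrand ξ y ∂ν

end LevyGen

namespace LevyGen

/-! ### One-parameter multiplicative semigroups in `ℂ` -/

/-! Everything is read off from the characteristic functions `φ_t` of `X_t`. Independent stationary
increments make `t ↦ φ_t(ξ)` multiplicative, and continuity in probability makes it continuous, so
`φ_t(ξ) = exp(-tψ(ξ))`. No logarithm is chosen: `ψ = (1 - φ_δ) / ∫₀^δ φ_s ds` as soon as the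
integral is nonzero, and one `δ` serves a whole ball of `ξ`, which makes `ψ` continuous.
Trigonometric doubling inequalities for `φ_t`, divided by `t` and passed to the limit, give `|ψ(ξ)|
≤ C(1 + |ξ|²)`.

For a test function `u`, Fourier inversion gives `P_t u(x) = ∫ û φ_t exp(ix·ξ) dξ`. Since `(φ_t -
1)/t → -ψ`, dominated by `|ψ|`, and `û` decays rapidly, the difference quotients converge uniformly
to `-ψ(D)u`, which vanishes at infinity by Riemann-Lebesgue. This is (b).

For (c), the finite measures `t⁻¹(1 - exp(-|y|²/2)) P(X_t ∈ dy)`, with a unit mass added at `0`,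
have characteristic functions that converge to a continuous limit, so they have a weak limit point
`ρ` (`exists_weak_limit`). The quotient `(φ_t - 1)/t` is a linear form plus a quadratic form plus
the integral of a bounded continuous function that vanishes at `0` against these measures
(`charFun_sub_one_div_eq`). The integral converges along an ultrafilter, hence so do the two forms;
unweighting `ρ` away from `0` gives `ν`. Positivity of `Q` follows from `Re ψ ≥ 0` by scaling.

Finally, by Fubini, the integro-differential operator of any triplet has symbol minus its
Lévy-Khintchine function (`IsTest.levyOperator_eq`). So (c) turns (b) into (a), and injectivity of
the Fourier transform gives the converse. -/

theorem continuous_of_mul_of_small {f : ℝ≥0 → ℂ} (hmul : ∀ s t, f (s + t) = f s * f t)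
    (hle : ∀ t, ‖f t‖ ≤ 1) (hsmall : ∀ ε > 0, ∃ δ : ℝ≥0, 0 < δ ∧ ∀ s ≤ δ, ‖f s - 1‖ ≤ ε) :
    Continuous f := by
  rw [Metric.continuous_iff]
  intro b ε hε
  obtain ⟨δ, hδ, h⟩ := hsmall (ε / 2) (by positivity)
  have key : ∀ s t : ℝ≥0, s ≤ t → dist s t < δ → dist (f s) (f t) < ε := by
    intro s t hst hd
    have e : t = s + (t - s) := (add_tsub_cancel_of_le hst).symm
    have h1 : t - s ≤ δ := by
      rw [← NNReal.coe_le_coe, NNReal.coe_sub hst]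
      rw [NNReal.dist_eq, abs_sub_comm] at hd
      exact (le_abs_self _).trans hd.le
    rw [dist_comm, dist_eq_norm]
    calc ‖f t - f s‖ = ‖f s * (f (t - s) - 1)‖ := by
          conv_lhs => rw [e, hmul]
          congr 1; ring
      _ ≤ 1 * (ε / 2) := by
          rw [norm_mul]; exact mul_le_mul (hle s) (h _ h1) (norm_nonneg _) zero_le_one
      _ < ε := by linarith
  refine ⟨δ, by exact_mod_cast hδ, fun a ha => ?_⟩
  rcases le_total a b with hab | hab
  · exact key a b hab ha
  · rw [dist_comm]; exact key b a hab (by rwa [dist_comm])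

/-- Integrating multiplicativity over `[0, δ]` gives `f(t) I = ∫_t^{t+δ} f`, so a merely continuous
`f` is differentiable and satisfies `f' = -z f`. The explicit `z` is what later shows continuity in
`ξ`. -/
theorem eq_exp_of_integral_ne_zero {f : ℝ≥0 → ℂ} (hf : Continuous f) (h0 : f 0 = 1)
    (hmul : ∀ s t, f (s + t) = f s * f t) (δ : ℝ≥0)
    (hI : ∫ s in (0 : ℝ)..δ, f s.toNNReal ≠ 0) (t : ℝ≥0) :
    f t = Complex.exp (-((t : ℝ) : ℂ) * ((1 - f δ) / ∫ s in (0 : ℝ)..δ, f s.toNNReal)) := by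
  set I := ∫ s in (0 : ℝ)..δ, f s.toNNReal with hIdef
  set z := (1 - f δ) / I with hz
  set g : ℝ → ℂ := fun s => f s.toNNReal with hg
  have hgc : Continuous g := hf.comp continuous_real_toNNReal
  have hgm : ∀ s t : ℝ, 0 ≤ s → 0 ≤ t → g (s + t) = g s * g t := by
    intro s t hs ht
    simp only [hg, Real.toNNReal_add hs ht, hmul]
  have hsh : ∀ t : ℝ, 0 ≤ t → g t * I = ∫ s in t..t + δ, g s := by
    intro t ht
    have : ∫ s in (0 : ℝ)..δ, g (s + t) = ∫ s in t..t + δ, g s := by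
      rw [intervalIntegral.integral_comp_add_right]; congr 1 <;> ring
    rw [← this, hIdef, ← intervalIntegral.integral_const_mul]
    refine intervalIntegral.integral_congr fun s hs => ?_
    rw [Set.uIcc_of_le (by positivity)] at hs
    rw [hgm s t hs.1 ht, mul_comm]
  have hd : ∀ t : ℝ, 0 ≤ t → HasDerivWithinAt g (-z * g t) (Set.Ici t) t := by
    intro t ht
    have h1 : HasDerivAt (fun t => ∫ s in (0 : ℝ)..t, g s) (g t) t :=
      intervalIntegral.integral_hasDerivAt_right (hgc.intervalIntegrable _ _)
        (hgc.stronglyMeasurableAtFilter _ _) hgc.continuousAt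
    have h2 : HasDerivAt (fun t => ∫ s in (0 : ℝ)..t, g s) (g (t + δ)) (t + δ) :=
      intervalIntegral.integral_hasDerivAt_right (hgc.intervalIntegrable _ _)
        (hgc.stronglyMeasurableAtFilter _ _) hgc.continuousAt
    have h3 := ((h2.comp_add_const t (δ : ℝ)).sub h1).div_const I
    have h4 : (g (t + δ) - g t) / I = -z * g t := by
      rw [hgm t δ ht (by positivity), hz]
      simp only [hg, Real.toNNReal_coe]
      ring
    rw [h4] at h3
    refine h3.hasDerivWithinAt.congr (fun s hs => ?_) ?_
    · rw [eq_div_iff hI, hsh s (ht.trans hs)]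
      exact (intervalIntegral.integral_interval_sub_left (hgc.intervalIntegrable _ _)
        (hgc.intervalIntegrable _ _)).symm
    · rw [eq_div_iff hI, hsh t ht]
      exact (intervalIntegral.integral_interval_sub_left (hgc.intervalIntegrable _ _)
        (hgc.intervalIntegrable _ _)).symm
  have hexp : ∀ t : ℝ, HasDerivAt (fun s : ℝ => Complex.exp (s * z)) (Complex.exp (t * z) * z) t := by
    intro t
    have h1 : HasDerivAt (fun s : ℝ => (s : ℂ) * z) z t := by
      simpa using (Complex.ofRealCLM.hasDerivAt (x := t)).mul_const z
    exact h1.cexp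
  -- Right derivatives suffice, and only these are at hand, since `g` is multiplicative on
  -- nonnegative times only.
  have hconst := constant_of_has_deriv_right_zero (f := fun s : ℝ => g s * Complex.exp (s * z))
    (a := 0) (b := t) (by fun_prop) (fun s hs => by
      have h := (hd s hs.1).mul (hexp s).hasDerivWithinAt
      have e : -z * g s * Complex.exp (s * z) + g s * (Complex.exp (s * z) * z) = 0 := by ring
      rw [e] at h
      exact h) t ⟨by positivity, le_rfl⟩
  simp only [hg, Real.toNNReal_coe, Real.toNNReal_zero, h0] at hconst
  rw [neg_mul, Complex.exp_neg, ← mul_one (Complex.exp _)⁻¹, eq_inv_mul_iff_mul_eq₀ (Complex.exp_ne_zero _),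
    mul_comm, hconst]
  simp

/-- Any exponent satisfies this for every `δ`, so exponents chosen separately for each `ξ` are all
given by one formula with a common `δ`. -/
theorem integral_mul_eq_of_eq_exp {f : ℝ≥0 → ℂ} {z : ℂ}
    (h : ∀ t : ℝ≥0, f t = Complex.exp (-((t : ℝ) : ℂ) * z)) (δ : ℝ≥0) :
    z * ∫ s in (0 : ℝ)..δ, f s.toNNReal = 1 - f δ := by
  by_cases hz : z = 0
  · simp [hz, h]
  · have e : ∫ s in (0 : ℝ)..δ, f s.toNNReal = ∫ s in (0 : ℝ)..δ, Complex.exp (-z * s) := by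
      refine intervalIntegral.integral_congr fun s hs => ?_
      rw [Set.uIcc_of_le (by positivity)] at hs
      rw [h, Real.coe_toNNReal _ hs.1]
      congr 1; ring
    rw [e, integral_exp_mul_complex (neg_ne_zero.mpr hz), h]
    rw [show -z * ((δ : ℝ) : ℂ) = -((δ : ℝ) : ℂ) * z by ring]
    field_simp
    simp

theorem integral_ne_zero_of_norm_sub_one_le {f : ℝ≥0 → ℂ} (hf : Continuous f) {δ : ℝ≥0} (hδ : 0 < δ)
    (h : ∀ s ≤ δ, ‖f s - 1‖ ≤ 1 / 2) : ∫ s in (0 : ℝ)..δ, f s.toNNReal ≠ 0 := by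
  intro h0
  have hgc : Continuous fun s : ℝ => f s.toNNReal := hf.comp continuous_real_toNNReal
  have h1 : ∫ s in (0 : ℝ)..δ, (f s.toNNReal - 1) = -((δ : ℝ) : ℂ) := by
    rw [intervalIntegral.integral_sub (hgc.intervalIntegrable _ _) (by simp), h0]
    simp
  have h2 : ‖∫ s in (0 : ℝ)..δ, (f s.toNNReal - 1)‖ ≤ 1 / 2 * |(δ : ℝ) - 0| := by
    refine intervalIntegral.norm_integral_le_of_norm_le_const fun s hs => ?_
    rw [Set.uIoc_of_le (by positivity)] at hs
    exact h _ (Real.toNNReal_le_iff_le_coe.mpr hs.2)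
  have hδ' : (0 : ℝ) < δ := by exact_mod_cast hδ
  rw [h1, norm_neg, Complex.norm_real, Real.norm_of_nonneg hδ'.le, sub_zero, abs_of_pos hδ'] at h2
  linarith

/-- The exponential is 1-Lipschitz on the closed left half-plane. This dominates `(φ_t - 1)/t` by
`|ψ|`, uniformly in `t`. -/
theorem norm_exp_neg_sub_one_le {z : ℂ} (hz : 0 ≤ z.re) : ‖Complex.exp (-z) - 1‖ ≤ ‖z‖ := by
  have hs : Convex ℝ {w : ℂ | w.re ≤ 0} := convex_halfSpace_re_le 0
  have h := hs.norm_image_sub_le_of_norm_hasDerivWithin_le (f := Complex.exp) (f' := Complex.exp)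
    (C := 1) (x := 0) (y := -z) (fun w _ => (Complex.hasDerivAt_exp w).hasDerivWithinAt)
    (fun w hw => by
      rw [Complex.norm_exp]; exact Real.exp_le_one_iff.mpr hw) (by simp) (by simpa using hz)
  simpa using h

/-! ### The characteristic exponent -/

section Exponent

variable {Ω : Type*} [MeasurableSpace Ω] {P : Measure Ω}
  {d : ℕ} {X : ℝ≥0 → Ω → E d}

theorem IsLevyProcess.charFun_eq (hX : IsLevyProcess X P) (t : ℝ≥0) (ξ : E d) :
    charFun (P.map (X t)) ξ = ∫ w, Complex.exp (Complex.I * (inner ℝ ξ (X t w) : ℝ)) ∂P := by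
  rw [charFun_apply, integral_map (hX.measurable t).aemeasurable (by fun_prop)]
  refine integral_congr_ae (.of_forall fun w => ?_)
  simp only
  rw [real_inner_comm, mul_comm]

theorem IsLevyProcess.map_sub (hX : IsLevyProcess X P) (s t : ℝ≥0) :
    P.map (fun w => X (s + t) w - X s w) = P.map (X t) := by
  have h := (hX.stationary s (s + t) (by simp)).map_eq
  rw [add_tsub_cancel_left] at h
  rw [h]
  refine Measure.map_congr ?_
  filter_upwards [hX.start_zero] with w hw
  simp [hw]

/-- The property of a characteristic exponent, in terms of the characteristic functions. -/
theorem IsCharacteristicExponent.charFun_eq {ψ : E d → ℂ} (hψ : IsCharacteristicExponent X P ψ)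
    (hX : IsLevyProcess X P) (t : ℝ≥0) (ξ : E d) :
    charFun (P.map (X t)) ξ = Complex.exp (-((t : ℝ) : ℂ) * ψ ξ) := by
  rw [hX.charFun_eq, hψ.2]

variable [IsProbabilityMeasure P]

theorem IsLevyProcess.isProbabilityMeasure_map (hX : IsLevyProcess X P) (t : ℝ≥0) :
    IsProbabilityMeasure (P.map (X t)) :=
  Measure.isProbabilityMeasure_map (hX.measurable t).aemeasurable

theorem IsLevyProcess.charFun_zero_time (hX : IsLevyProcess X P) (ξ : E d) :
    charFun (P.map (X 0)) ξ = 1 := by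
  rw [hX.charFun_eq, integral_congr_ae (g := fun _ => (1 : ℂ))]
  · simp
  · filter_upwards [hX.start_zero] with w hw
    simp [hw]

theorem IsLevyProcess.charFun_add (hX : IsLevyProcess X P) (s t : ℝ≥0) (ξ : E d) :
    charFun (P.map (X (s + t))) ξ = charFun (P.map (X s)) ξ * charFun (P.map (X t)) ξ := by
  have hi : IndepFun (X s) (fun w => X (s + t) w - X s w) P := by
    rw [IndepFun_iff_Indep]
    refine (indep_of_indep_of_le_right (hX.indep s (s + t) (by simp)) ?_).symm
    exact le_iSup₂_of_le s le_rfl le_rfl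
  have h : charFun (P.map fun w => X s w + (X (s + t) w - X s w))
      = charFun (P.map (X s)) * charFun (P.map fun w => X (s + t) w - X s w) :=
    hi.charFun_map_fun_add_eq_mul (hX.measurable s).aemeasurable
    ((hX.measurable (s + t)).sub (hX.measurable s)).aemeasurable
  rw [hX.map_sub] at h
  simp only [add_sub_cancel] at h
  exact congrFun h ξ

/-- Uniformity over `‖ξ‖ ≤ R` is the point. The integrand is at most `2` on the rare event of a
large increment and at most `‖ξ‖ ‖X_s‖` off it; each part contributes at most `ε / 2`. -/
theorem IsLevyProcess.charFun_sub_one_small (hX : IsLevyProcess X P) (R : ℝ) (ε : ℝ) (hε : 0 < ε) :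
    ∃ δ : ℝ≥0, 0 < δ ∧ ∀ s ≤ δ, ∀ ξ : E d, ‖ξ‖ ≤ R → ‖charFun (P.map (X s)) ξ - 1‖ ≤ ε := by
  set η : ℝ := ε / (2 * (|R| + 1)) with hη
  have hη0 : 0 < η := by positivity
  have hev : ∀ᶠ t : ℝ≥0 in 𝓝[>] 0,
      P {w | η < ‖X t w - X 0 w‖} < ENNReal.ofReal (ε / 4) :=
    (hX.cont_prob η hη0).eventually_lt_const (by simpa using hε)
  obtain ⟨δ', hδ', hsub⟩ := (mem_nhdsGT_iff_exists_Ioo_subset' (zero_lt_one' ℝ≥0)).mp hev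
  have hδ'0 : (0 : ℝ≥0) < δ' := hδ'
  refine ⟨δ' / 2, half_pos hδ'0, fun s hs ξ hξ => ?_⟩
  -- Continuity in probability is a limit over `s > 0` only, so `s = 0` is treated apart.
  rcases eq_or_ne s 0 with rfl | hs0
  · rw [hX.charFun_zero_time]; simpa using hε.le
  have hsI : s ∈ Set.Ioo 0 δ' :=
    ⟨pos_iff_ne_zero.mpr hs0, hs.trans_lt (half_lt_self hδ'0)⟩
  have hP : P {w | η < ‖X s w - X 0 w‖} < ENNReal.ofReal (ε / 4) := hsub hsI
  set S := {w | η < ‖X s w - X 0 w‖} with hS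
  have hSm : MeasurableSet S :=
    measurableSet_lt measurable_const ((hX.measurable s).sub (hX.measurable 0)).norm
  have hreal : P.real S ≤ ε / 4 := by
    rw [Measure.real]
    exact ENNReal.toReal_le_of_le_ofReal (by positivity) hP.le
  have hm : Measurable fun w => Complex.exp (Complex.I * (inner ℝ ξ (X s w) : ℝ)) := by
    have := hX.measurable s
    fun_prop
  have hn : ∀ w, ‖Complex.exp (Complex.I * (inner ℝ ξ (X s w) : ℝ))‖ = 1 := fun w => by
    rw [mul_comm, Complex.norm_exp_ofReal_mul_I]
  have hint : Integrable (fun w => Complex.exp (Complex.I * (inner ℝ ξ (X s w) : ℝ))) P :=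
    Integrable.of_bound hm.aestronglyMeasurable 1 (.of_forall fun w => (hn w).le)
  rw [hX.charFun_eq]
  have e : ∫ w, Complex.exp (Complex.I * (inner ℝ ξ (X s w) : ℝ)) ∂P - 1
      = ∫ w, (Complex.exp (Complex.I * (inner ℝ ξ (X s w) : ℝ)) - 1) ∂P := by
    rw [integral_sub hint (integrable_const _)]; simp
  rw [e]
  have hb : ∀ᵐ w ∂P, ‖Complex.exp (Complex.I * (inner ℝ ξ (X s w) : ℝ)) - 1‖
      ≤ ε / 2 + S.indicator (fun _ => (2 : ℝ)) w := by
    filter_upwards [hX.start_zero] with w hw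
    by_cases hwS : w ∈ S
    · rw [Set.indicator_of_mem hwS]
      calc _ ≤ ‖Complex.exp (Complex.I * (inner ℝ ξ (X s w) : ℝ))‖ + ‖(1 : ℂ)‖ := norm_sub_le _ _
        _ = 2 := by rw [hn]; norm_num
        _ ≤ _ := by linarith
    · rw [Set.indicator_of_notMem hwS, add_zero]
      have hx : ‖X s w‖ ≤ η := by
        simpa [hS, hw] using hwS
      calc _ ≤ ‖(inner ℝ ξ (X s w) : ℝ)‖ := Real.norm_exp_I_mul_ofReal_sub_one_le
        _ ≤ ‖ξ‖ * ‖X s w‖ := norm_inner_le_norm _ _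
        _ ≤ (|R| + 1) * η := by
          gcongr
          exact hξ.trans ((le_abs_self R).trans (by linarith))
        _ = ε / 2 := by rw [hη]; field_simp
  have hi2 : Integrable (S.indicator (fun _ => (2 : ℝ))) P :=
    (integrable_const _).indicator hSm
  calc _ ≤ ∫ w, (ε / 2 + S.indicator (fun _ => (2 : ℝ)) w) ∂P :=
        norm_integral_le_of_norm_le ((integrable_const _).add hi2) hb
    _ = ε / 2 + P.real S * 2 := by
        rw [integral_add (integrable_const _) hi2, integral_indicator_const _ hSm]; simp
    _ ≤ ε := by linarith

theorem IsLevyProcess.continuous_charFun_time (hX : IsLevyProcess X P) (ξ : E d) :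
    Continuous fun t => charFun (P.map (X t)) ξ := by
  refine continuous_of_mul_of_small (fun s t => hX.charFun_add s t ξ) (fun t => ?_) fun ε hε => ?_
  · have := hX.isProbabilityMeasure_map t
    exact norm_charFun_le_one _
  · obtain ⟨δ, hδ, h⟩ := hX.charFun_sub_one_small ‖ξ‖ ε hε
    exact ⟨δ, hδ, fun s hs => h s hs ξ le_rfl⟩

theorem IsLevyProcess.exists_exponent (hX : IsLevyProcess X P) :
    ∃ ψ : E d → ℂ, Continuous ψ ∧ ∀ (t : ℝ≥0) (ξ : E d),
      charFun (P.map (X t)) ξ = Complex.exp (-((t : ℝ) : ℂ) * ψ ξ) := by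
  have hne : ∀ R : ℝ, ∃ δ : ℝ≥0, ∀ ξ : E d, ‖ξ‖ ≤ R →
      ∫ s in (0 : ℝ)..δ, charFun (P.map (X s.toNNReal)) ξ ≠ 0 := by
    intro R
    obtain ⟨δ, hδ, h⟩ := hX.charFun_sub_one_small R (1 / 2) (by norm_num)
    exact ⟨δ, fun ξ hξ => integral_ne_zero_of_norm_sub_one_le (hX.continuous_charFun_time ξ) hδ
      fun s hs => h s hs ξ hξ⟩
  have hex : ∀ ξ : E d, ∃ z : ℂ, ∀ t : ℝ≥0,
      charFun (P.map (X t)) ξ = Complex.exp (-((t : ℝ) : ℂ) * z) := by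
    intro ξ
    obtain ⟨δ, h⟩ := hne ‖ξ‖
    exact ⟨_, eq_exp_of_integral_ne_zero (hX.continuous_charFun_time ξ) (hX.charFun_zero_time ξ)
      (fun s t => hX.charFun_add s t ξ) δ (h ξ le_rfl)⟩
  choose ψ hψ using hex
  refine ⟨ψ, ?_, fun t ξ => hψ ξ t⟩
  rw [continuous_iff_continuousAt]
  intro ξ₀
  obtain ⟨δ, h⟩ := hne (‖ξ₀‖ + 1)
  have hcont : ∀ t, Continuous (charFun (P.map (X t))) := fun t => by
    have := hX.isProbabilityMeasure_map t
    exact continuous_charFun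
  have hIc : Continuous fun ξ : E d => ∫ s in (0 : ℝ)..δ, charFun (P.map (X s.toNNReal)) ξ := by
    refine intervalIntegral.continuous_of_dominated_interval (bound := fun _ => 1)
      (fun ξ => ?_) (fun ξ => .of_forall fun s _ => ?_) (by simp)
      (.of_forall fun s _ => hcont _)
    · exact ((hX.continuous_charFun_time ξ).comp continuous_real_toNNReal).aestronglyMeasurable
    · have := hX.isProbabilityMeasure_map s.toNNReal
      exact norm_charFun_le_one _
  -- On the unit ball about `ξ₀`, the exponent coincides with this quotient of continuous functions,
  -- whose denominator does not vanish.
  have hq : ContinuousAt (fun ξ : E d => (1 - charFun (P.map (X δ)) ξ) /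
      ∫ s in (0 : ℝ)..δ, charFun (P.map (X s.toNNReal)) ξ) ξ₀ :=
    (continuous_const.sub (hcont δ)).continuousAt.div hIc.continuousAt (h ξ₀ (by linarith))
  refine hq.congr ?_
  filter_upwards [Metric.ball_mem_nhds ξ₀ one_pos] with ξ hξ
  have hξ' : ‖ξ‖ ≤ ‖ξ₀‖ + 1 := by
    rw [mem_ball_iff_norm] at hξ
    linarith [norm_le_norm_add_norm_sub' ξ ξ₀]
  rw [div_eq_iff (h ξ hξ'), integral_mul_eq_of_eq_exp (hψ ξ) δ]

theorem IsLevyProcess.exists_isCharacteristicExponent (hX : IsLevyProcess X P) :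
    ∃ ψ : E d → ℂ, IsCharacteristicExponent X P ψ := by
  obtain ⟨ψ, hc, h⟩ := hX.exists_exponent
  exact ⟨ψ, hc, fun t ξ => by rw [← hX.charFun_eq, h]⟩

theorem IsCharacteristicExponent.re_nonneg {ψ : E d → ℂ} (hψ : IsCharacteristicExponent X P ψ)
    (hX : IsLevyProcess X P) (ξ : E d) : 0 ≤ (ψ ξ).re := by
  have := hX.isProbabilityMeasure_map 1
  have h := norm_charFun_le_one (μ := P.map (X 1)) (t := ξ)
  rw [hψ.charFun_eq hX, Complex.norm_exp, Real.exp_le_one_iff] at h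
  simpa using h

theorem norm_exp_sub_one_div_le {z : ℂ} (hz : 0 ≤ z.re) (t : ℝ≥0) :
    ‖(Complex.exp (-((t : ℝ) : ℂ) * z) - 1) / ((t : ℝ) : ℂ)‖ ≤ ‖z‖ := by
  have h := norm_exp_neg_sub_one_le (z := ((t : ℝ) : ℂ) * z)
    (by simpa using mul_nonneg t.coe_nonneg hz)
  rw [← neg_mul] at h
  rw [norm_div]
  refine div_le_of_le_mul₀ (norm_nonneg _) (norm_nonneg _) (h.trans_eq ?_)
  rw [norm_mul, mul_comm]

theorem tendsto_exp_sub_one_div (z : ℂ) :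
    Tendsto (fun t : ℝ≥0 => (Complex.exp (-((t : ℝ) : ℂ) * z) - 1) / ((t : ℝ) : ℂ))
      (𝓝[>] 0) (𝓝 (-z)) := by
  have h1 : HasDerivAt (fun t : ℝ => Complex.exp (-(t : ℂ) * z)) (-z) 0 := by
    have h : HasDerivAt (fun s : ℝ => -(s : ℂ) * z) (-z) 0 := by
      simpa using ((Complex.ofRealCLM.hasDerivAt (x := 0)).neg).mul_const z
    simpa using h.cexp
  have h2 := h1.tendsto_slope_zero_right
  have h3 : Tendsto (fun t : ℝ≥0 => (t : ℝ)) (𝓝[>] 0) (𝓝[>] 0) := by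
    refine tendsto_nhdsWithin_of_tendsto_nhds_of_eventually_within _ ?_ ?_
    · exact (NNReal.continuous_coe.tendsto' 0 0 (by simp)).mono_left nhdsWithin_le_nhds
    · filter_upwards [self_mem_nhdsWithin] with t ht
      exact NNReal.coe_pos.mpr ht
  refine (h2.comp h3).congr fun t => ?_
  simp [div_eq_inv_mul]

end Exponent

/-! ### Quadratic growth of the characteristic exponent -/

section Growth

variable {d : ℕ}

theorem integrable_cexp_inner (μ : Measure (E d)) [IsFiniteMeasure μ] (ξ : E d) :
    Integrable (fun x : E d => Complex.exp ((inner ℝ x ξ : ℝ) * Complex.I)) μ :=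
  Integrable.of_bound (by fun_prop) 1 (.of_forall fun x => by rw [Complex.norm_exp_ofReal_mul_I])

theorem re_charFun (μ : Measure (E d)) [IsFiniteMeasure μ] (ξ : E d) :
    (charFun μ ξ).re = ∫ x, Real.cos (inner ℝ x ξ) ∂μ := by
  rw [charFun_apply]
  refine (integral_re (integrable_cexp_inner μ ξ)).symm.trans ?_
  refine integral_congr_ae (.of_forall fun x => ?_)
  exact Complex.exp_ofReal_mul_I_re _

theorem im_charFun (μ : Measure (E d)) [IsFiniteMeasure μ] (ξ : E d) :
    (charFun μ ξ).im = ∫ x, Real.sin (inner ℝ x ξ) ∂μ := by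
  rw [charFun_apply]
  refine (integral_im (integrable_cexp_inner μ ξ)).symm.trans ?_
  refine integral_congr_ae (.of_forall fun x => ?_)
  exact Complex.exp_ofReal_mul_I_im _

theorem integrable_cos_inner (μ : Measure (E d)) [IsFiniteMeasure μ] (ξ : E d) :
    Integrable (fun x : E d => Real.cos (inner ℝ x ξ)) μ :=
  Integrable.of_bound (by fun_prop) 1 (.of_forall fun x => Real.abs_cos_le_one _)

theorem integrable_sin_inner (μ : Measure (E d)) [IsFiniteMeasure μ] (ξ : E d) :
    Integrable (fun x : E d => Real.sin (inner ℝ x ξ)) μ :=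
  Integrable.of_bound (by fun_prop) 1 (.of_forall fun x => Real.abs_sin_le_one _)

/-- Pointwise, `1 - cos 2θ = 2(1 - cos θ)(1 + cos θ) ≤ 4(1 - cos θ)`. -/
theorem one_sub_re_charFun_two_smul_le (μ : Measure (E d)) [IsProbabilityMeasure μ] (ξ : E d) :
    1 - (charFun μ ((2 : ℝ) • ξ)).re ≤ 4 * (1 - (charFun μ ξ).re) := by
  have e : ∀ η : E d, 1 - (charFun μ η).re = ∫ x, (1 - Real.cos (inner ℝ x η)) ∂μ := fun η => by
    rw [integral_sub (integrable_const _) (integrable_cos_inner μ η), re_charFun]; simp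
  rw [e, e, ← integral_const_mul]
  refine integral_mono ((integrable_const _).sub (integrable_cos_inner μ _))
    (((integrable_const _).sub (integrable_cos_inner μ _)).const_mul 4) fun x => ?_
  simp only [inner_smul_right, Real.cos_two_mul]
  nlinarith [Real.cos_le_one (inner ℝ x ξ), Real.neg_one_le_cos (inner ℝ x ξ)]

/-- Pointwise, `|sin 2θ - 2 sin θ| = 2|sin θ|(1 - cos θ) ≤ 2(1 - cos θ)`; the real part controls the
defect of linearity. -/
theorem abs_im_charFun_two_smul_le (μ : Measure (E d)) [IsProbabilityMeasure μ] (ξ : E d) :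
    |(charFun μ ((2 : ℝ) • ξ)).im| ≤ 2 * |(charFun μ ξ).im| + 2 * (1 - (charFun μ ξ).re) := by
  have h : |(charFun μ ((2 : ℝ) • ξ)).im - 2 * (charFun μ ξ).im| ≤ 2 * (1 - (charFun μ ξ).re) := by
    have e : 2 * (1 - (charFun μ ξ).re) = ∫ x, 2 * (1 - Real.cos (inner ℝ x ξ)) ∂μ := by
      rw [integral_const_mul, integral_sub (integrable_const _) (integrable_cos_inner μ ξ),
        re_charFun]
      simp
    rw [e, im_charFun, im_charFun, ← integral_const_mul, ← integral_sub
      (integrable_sin_inner μ _) ((integrable_sin_inner μ _).const_mul 2)]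
    rw [← Real.norm_eq_abs]
    refine norm_integral_le_of_norm_le
      (((integrable_const _).sub (integrable_cos_inner μ _)).const_mul 2) (.of_forall fun x => ?_)
    simp only [inner_smul_right, Real.sin_two_mul, Real.norm_eq_abs]
    have h1 := Real.cos_le_one (inner ℝ x ξ)
    rw [show ∀ s c : ℝ, 2 * s * c - 2 * s = -(2 * (s * (1 - c))) by intros; ring, abs_neg, abs_mul,
      abs_mul, abs_of_nonneg (sub_nonneg.mpr h1), abs_two]
    have h2 := Real.abs_sin_le_one (inner ℝ x ξ)
    nlinarith
  have h3 := abs_sub_abs_le_abs_sub (charFun μ ((2 : ℝ) • ξ)).im (2 * (charFun μ ξ).im)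
  rw [abs_mul, abs_two] at h3
  linarith

variable {Ω : Type*} [MeasurableSpace Ω] {P : Measure Ω}
  {X : ℝ≥0 → Ω → E d} {ψ : E d → ℂ}

theorem IsCharacteristicExponent.tendsto_charFun (hψ : IsCharacteristicExponent X P ψ)
    (hX : IsLevyProcess X P) (ξ : E d) :
    Tendsto (fun t : ℝ≥0 => (charFun (P.map (X t)) ξ - 1) / ((t : ℝ) : ℂ)) (𝓝[>] 0) (𝓝 (-ψ ξ)) := by
  simp only [hψ.charFun_eq hX]
  exact tendsto_exp_sub_one_div _

theorem IsCharacteristicExponent.tendsto_re (hψ : IsCharacteristicExponent X P ψ)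
    (hX : IsLevyProcess X P) (ξ : E d) :
    Tendsto (fun t : ℝ≥0 => (1 - (charFun (P.map (X t)) ξ).re) / (t : ℝ)) (𝓝[>] 0)
      (𝓝 (ψ ξ).re) := by
  have h := ((Complex.continuous_re.tendsto _).comp (hψ.tendsto_charFun hX ξ)).neg
  simp only [Complex.neg_re, neg_neg] at h
  refine h.congr fun t => ?_
  simp only [Function.comp_apply, Complex.div_ofReal_re, Complex.sub_re, Complex.one_re]
  ring

theorem IsCharacteristicExponent.tendsto_im (hψ : IsCharacteristicExponent X P ψ)
    (hX : IsLevyProcess X P) (ξ : E d) :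
    Tendsto (fun t : ℝ≥0 => |(charFun (P.map (X t)) ξ).im| / (t : ℝ)) (𝓝[>] 0)
      (𝓝 |(ψ ξ).im|) := by
  have h := ((Complex.continuous_im.tendsto _).comp (hψ.tendsto_charFun hX ξ)).abs
  simp only [Complex.neg_im, abs_neg] at h
  refine h.congr fun t => ?_
  simp only [Function.comp_apply, Complex.div_ofReal_im, Complex.sub_im, Complex.one_im, sub_zero,
    abs_div, abs_of_nonneg t.coe_nonneg]

variable [IsProbabilityMeasure P]

theorem IsCharacteristicExponent.re_two_smul_le (hψ : IsCharacteristicExponent X P ψ)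
    (hX : IsLevyProcess X P) (ξ : E d) : (ψ ((2 : ℝ) • ξ)).re ≤ 4 * (ψ ξ).re := by
  refine le_of_tendsto_of_tendsto (hψ.tendsto_re hX _) ((hψ.tendsto_re hX ξ).const_mul 4)
    (.of_forall fun t => ?_)
  have := hX.isProbabilityMeasure_map t
  simp only
  rw [← mul_div_assoc]
  exact div_le_div_of_nonneg_right (one_sub_re_charFun_two_smul_le _ ξ) t.coe_nonneg

theorem IsCharacteristicExponent.abs_im_two_smul_le (hψ : IsCharacteristicExponent X P ψ)
    (hX : IsLevyProcess X P) (ξ : E d) :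
    |(ψ ((2 : ℝ) • ξ)).im| ≤ 2 * |(ψ ξ).im| + 2 * (ψ ξ).re := by
  refine le_of_tendsto_of_tendsto (hψ.tendsto_im hX _)
    (((hψ.tendsto_im hX ξ).const_mul 2).add ((hψ.tendsto_re hX ξ).const_mul 2))
    (.of_forall fun t => ?_)
  have := hX.isProbabilityMeasure_map t
  simp only
  rw [← mul_div_assoc, ← mul_div_assoc, ← add_div]
  exact div_le_div_of_nonneg_right (abs_im_charFun_two_smul_le _ ξ) t.coe_nonneg

/-- Doubling `ξ` multiplies the bounds on the real and imaginary parts by at most `4`, so a bound on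
the unit ball propagates to quadratic growth. This makes `û ψ` integrable. -/
theorem IsCharacteristicExponent.exists_norm_le (hψ : IsCharacteristicExponent X P ψ)
    (hX : IsLevyProcess X P) : ∃ C : ℝ, 0 ≤ C ∧ ∀ ξ, ‖ψ ξ‖ ≤ C * (1 + ‖ξ‖ ^ 2) := by
  obtain ⟨M, hM⟩ := (isCompact_closedBall (0 : E d) 1).exists_bound_of_continuousOn
    hψ.1.continuousOn
  have hM0 : 0 ≤ M := (norm_nonneg _).trans (hM 0 (by simp))
  -- The imaginary part joins the induction because its two doubling coefficients add up to `2 + 2 =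
  -- 4`.
  have key : ∀ n : ℕ, ∀ ξ : E d, ‖ξ‖ ≤ 2 ^ n → (ψ ξ).re ≤ 4 ^ n * M ∧ |(ψ ξ).im| ≤ 4 ^ n * M := by
    intro n
    induction n with
    | zero =>
      intro ξ hξ
      have h := hM ξ (by simpa using hξ)
      simpa using And.intro ((Complex.re_le_norm _).trans h) ((Complex.abs_im_le_norm _).trans h)
    | succ n ih =>
      intro ξ hξ
      have e : ξ = (2 : ℝ) • ((2 : ℝ)⁻¹ • ξ) := by rw [smul_smul]; norm_num
      have hle : ‖(2 : ℝ)⁻¹ • ξ‖ ≤ 2 ^ n := by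
        rw [norm_smul]
        rw [pow_succ] at hξ
        norm_num
        linarith
      obtain ⟨h1, h2⟩ := ih _ hle
      rw [e]
      have h3 := hψ.re_two_smul_le hX ((2 : ℝ)⁻¹ • ξ)
      have h4 := hψ.abs_im_two_smul_le hX ((2 : ℝ)⁻¹ • ξ)
      rw [pow_succ]
      constructor <;> linarith
  refine ⟨2 * M * 4, by positivity, fun ξ => ?_⟩
  have hn : ∃ n : ℕ, ‖ξ‖ ≤ 2 ^ n ∧ (4 : ℝ) ^ n ≤ 4 * (1 + ‖ξ‖ ^ 2) := by
    rcases le_or_gt ‖ξ‖ 1 with h | h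
    · exact ⟨0, by simpa using h, by nlinarith [sq_nonneg ‖ξ‖]⟩
    · obtain ⟨n, h1, h2⟩ := exists_nat_pow_near h.le (one_lt_two (α := ℝ))
      refine ⟨n + 1, h2.le, ?_⟩
      have : (4 : ℝ) ^ (n + 1) = 4 * (2 ^ n) ^ 2 := by
        rw [← pow_mul, mul_comm n, pow_mul]; norm_num [pow_succ, mul_comm]
      rw [this]
      have : ((2 : ℝ) ^ n) ^ 2 ≤ ‖ξ‖ ^ 2 := by gcongr
      linarith
  obtain ⟨n, h1, h2⟩ := hn
  obtain ⟨h3, h4⟩ := key n ξ h1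
  calc ‖ψ ξ‖ ≤ |(ψ ξ).re| + |(ψ ξ).im| := Complex.norm_le_abs_re_add_abs_im _
    _ ≤ 4 ^ n * M + 4 ^ n * M := by
        rw [abs_of_nonneg (hψ.re_nonneg hX ξ)]; exact add_le_add h3 h4
    _ = 2 * M * 4 ^ n := by ring
    _ ≤ 2 * M * (4 * (1 + ‖ξ‖ ^ 2)) := by gcongr
    _ = _ := by ring

end Growth

/-! ### Estimates for the integrands -/

section Estimates

variable {d : ℕ}

/-- The function `1 - exp(-|y|² / 2)`, comparable with `min {1, |y|²}`. -/
noncomputable def gaussGap (y : E d) : ℝ := 1 - Real.exp (-‖y‖ ^ 2 / 2)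

/-- A smooth bounded vector field which is close to the identity near the origin. -/
noncomputable def softTrunc (y : E d) : E d := Real.exp (-‖y‖ ^ 2 / 2) • y

@[fun_prop]
theorem continuous_gaussGap : Continuous (gaussGap (d := d)) := by
  unfold gaussGap; fun_prop

@[fun_prop]
theorem continuous_softTrunc : Continuous (softTrunc (d := d)) := by
  unfold softTrunc; fun_prop

@[simp]
theorem gaussGap_zero : gaussGap (0 : E d) = 0 := by simp [gaussGap]

theorem gaussGap_nonneg (y : E d) : 0 ≤ gaussGap y := by
  unfold gaussGap
  have : Real.exp (-‖y‖ ^ 2 / 2) ≤ 1 := Real.exp_le_one_iff.mpr (by nlinarith [sq_nonneg ‖y‖])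
  linarith

theorem gaussGap_le_one (y : E d) : gaussGap y ≤ 1 := by
  unfold gaussGap
  linarith [Real.exp_pos (-‖y‖ ^ 2 / 2)]

theorem gaussGap_le (y : E d) : gaussGap y ≤ min 1 (‖y‖ ^ 2) := by
  refine le_min (gaussGap_le_one y) ?_
  unfold gaussGap
  nlinarith [Real.add_one_le_exp (-‖y‖ ^ 2 / 2), sq_nonneg ‖y‖]

/-- From `exp(-s) ≤ 1/(1 + s) ≤ 1 - s/2` on `[0, 1]`, used at `s = |y|²/2` inside the unit ball and
at `s = 1/2` outside; both give the constant `4`. -/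
theorem le_gaussGap (y : E d) : min 1 (‖y‖ ^ 2) ≤ 4 * gaussGap y := by
  have key : ∀ s : ℝ, 0 ≤ s → s ≤ 1 → s / 2 ≤ 1 - Real.exp (-s) := by
    intro s h0 h1
    have h2 := Real.add_one_le_exp s
    rw [Real.exp_neg]
    have h3 : (Real.exp s)⁻¹ ≤ (s + 1)⁻¹ := inv_anti₀ (by linarith) h2
    have h4 : (s + 1)⁻¹ ≤ 1 - s / 2 := by
      rw [inv_le_comm₀ (by linarith) (by linarith), inv_le_iff_one_le_mul₀ (by linarith)]
      nlinarith
    linarith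
  unfold gaussGap
  rcases le_total (‖y‖ ^ 2) 1 with h | h
  · rw [min_eq_right h]
    have := key (‖y‖ ^ 2 / 2) (by positivity) (by linarith)
    rw [neg_div]
    linarith
  · rw [min_eq_left h]
    have h1 := key (1 / 2) (by norm_num) (by norm_num)
    have h2 : Real.exp (-‖y‖ ^ 2 / 2) ≤ Real.exp (-(1 / 2)) := Real.exp_le_exp.mpr (by linarith)
    linarith

theorem gaussGap_pos {y : E d} (hy : y ≠ 0) : 0 < gaussGap y := by
  have h : 0 < min 1 (‖y‖ ^ 2) := lt_min one_pos (by positivity)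
  linarith [le_gaussGap y]

theorem norm_softTrunc_eq (y : E d) : ‖softTrunc y‖ = Real.exp (-‖y‖ ^ 2 / 2) * ‖y‖ := by
  rw [softTrunc, norm_smul, Real.norm_of_nonneg (Real.exp_pos _).le]

theorem norm_softTrunc_le_one (y : E d) : ‖softTrunc y‖ ≤ 1 := by
  rw [norm_softTrunc_eq, neg_div, Real.exp_neg, inv_mul_le_iff₀ (Real.exp_pos _)]
  nlinarith [Real.add_one_le_exp (‖y‖ ^ 2 / 2), sq_nonneg (‖y‖ - 1)]

theorem norm_softTrunc_le (y : E d) : ‖softTrunc y‖ ≤ ‖y‖ := by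
  rw [norm_softTrunc_eq]
  refine mul_le_of_le_one_left (norm_nonneg _) (Real.exp_le_one_iff.mpr ?_)
  nlinarith [sq_nonneg ‖y‖]

theorem sq_norm_softTrunc_le (y : E d) : ‖softTrunc y‖ ^ 2 ≤ min 1 (‖y‖ ^ 2) :=
  le_min (pow_le_one₀ (norm_nonneg _) (norm_softTrunc_le_one y))
    (pow_le_pow_left₀ (norm_nonneg _) (norm_softTrunc_le y) 2)

@[fun_prop]
theorem measurable_trunc : Measurable (trunc (d := d)) :=
  (measurable_const.indicator measurableSet_Ioo).comp measurable_norm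

theorem trunc_of_one_le {y : E d} (hy : 1 ≤ ‖y‖) : trunc y = 0 :=
  Set.indicator_of_notMem (fun h => absurd h.2 (not_lt.mpr hy)) _

theorem trunc_smul_of_lt_one {y : E d} (hy : ‖y‖ < 1) : trunc y • y = y := by
  rcases eq_or_ne y 0 with rfl | h
  · simp
  · rw [trunc, Set.indicator_of_mem (show ‖y‖ ∈ Set.Ioo (0 : ℝ) 1 from ⟨norm_pos_iff.mpr h, hy⟩), one_smul]

/-- The smooth cut-off is needed for weak limits, the sharp one for the statement. Their difference
is `gaussGap y • y` inside the unit ball and bounded outside, so it is integrable for every Lévy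
measure and only shifts the drift. -/
theorem norm_trunc_smul_sub_softTrunc_le (y : E d) :
    ‖trunc y • y - softTrunc y‖ ≤ min 1 (‖y‖ ^ 2) := by
  rcases lt_or_ge ‖y‖ 1 with h | h
  · rw [trunc_smul_of_lt_one h]
    have e : y - softTrunc y = gaussGap y • y := by
      rw [softTrunc, gaussGap, sub_smul, one_smul]
    rw [e, norm_smul, Real.norm_of_nonneg (gaussGap_nonneg y)]
    calc gaussGap y * ‖y‖ ≤ gaussGap y * 1 := by
          gcongr
          exact gaussGap_nonneg y
      _ ≤ _ := by rw [mul_one]; exact gaussGap_le y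
  · rw [trunc_of_one_le h, zero_smul, zero_sub, norm_neg, min_eq_left (one_le_pow₀ h)]
    exact norm_softTrunc_le_one y

theorem norm_cexp_I_sub_sub_le (θ : ℝ) :
    ‖1 - Complex.exp (Complex.I * θ) + Complex.I * θ‖ ≤ 3 * θ ^ 2 := by
  have hn : ‖Complex.I * (θ : ℂ)‖ = |θ| := by simp
  rcases le_total |θ| 1 with h | h
  · have h1 := Complex.exp_bound (x := Complex.I * θ) (by rw [hn]; exact h) (n := 2) (by norm_num)
    rw [hn, sq_abs] at h1
    rw [← norm_neg]
    simp only [Finset.sum_range_succ, Finset.sum_range_zero] at h1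
    norm_num at h1
    rw [show -(1 - Complex.exp (Complex.I * θ) + Complex.I * θ)
      = Complex.exp (Complex.I * θ) - (1 + Complex.I * θ) by ring]
    nlinarith [sq_nonneg θ]
  · calc _ ≤ ‖1 - Complex.exp (Complex.I * θ)‖ + ‖Complex.I * (θ : ℂ)‖ := norm_add_le _ _
      _ ≤ (‖(1 : ℂ)‖ + ‖Complex.exp (Complex.I * θ)‖) + |θ| := by
          rw [hn]; gcongr; exact norm_sub_le _ _
      _ = 2 + |θ| := by rw [mul_comm, Complex.norm_exp_ofReal_mul_I]; norm_num
      _ ≤ 3 * θ ^ 2 := by rw [← sq_abs]; nlinarith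

/-- The product form of the bound, quadratic in `ξ` and the Lévy weight in `y`, yields at once
integrability, quadratic growth of the symbol and the use of Fubini. Inside the unit ball it is a
second-order Taylor bound, outside a trivial one. -/
theorem norm_lkIntegrand_le (ξ y : E d) :
    ‖lkIntegrand ξ y‖ ≤ 3 * (1 + ‖ξ‖ ^ 2) * min 1 (‖y‖ ^ 2) := by
  have hle : |(inner ℝ y ξ : ℝ)| ≤ ‖y‖ * ‖ξ‖ := abs_real_inner_le_norm _ _
  rcases lt_or_ge ‖y‖ 1 with h | h
  · have e : lkIntegrand ξ y = 1 - Complex.exp (Complex.I * (inner ℝ y ξ : ℝ))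
        + Complex.I * (inner ℝ y ξ : ℝ) := by
      have : (inner ℝ ξ y : ℝ) * trunc y = inner ℝ y ξ := by
        rw [mul_comm, ← real_inner_smul_right, trunc_smul_of_lt_one h, real_inner_comm]
      rw [lkIntegrand, mul_assoc, ← Complex.ofReal_mul, this]
    rw [e, min_eq_right (pow_le_one₀ (norm_nonneg _) h.le)]
    refine (norm_cexp_I_sub_sub_le _).trans ?_
    have h2 : (inner ℝ y ξ : ℝ) ^ 2 ≤ (‖y‖ * ‖ξ‖) ^ 2 := by
      rw [← sq_abs]; gcongr
    nlinarith [sq_nonneg ‖y‖]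
  · rw [lkIntegrand, trunc_of_one_le h, min_eq_left (one_le_pow₀ h), mul_one]
    simp only [Complex.ofReal_zero, mul_zero, add_zero]
    calc _ ≤ ‖(1 : ℂ)‖ + ‖Complex.exp (Complex.I * (inner ℝ y ξ : ℝ))‖ := norm_sub_le _ _
      _ = 2 := by rw [mul_comm, Complex.norm_exp_ofReal_mul_I]; norm_num
      _ ≤ _ := by nlinarith [sq_nonneg ‖ξ‖]

theorem measurable_uncurry_lkIntegrand :
    Measurable (Function.uncurry (lkIntegrand (d := d))) := by
  unfold lkIntegrand Function.uncurry
  fun_prop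

theorem continuous_lkIntegrand_left (y : E d) : Continuous fun ξ => lkIntegrand ξ y := by
  unfold lkIntegrand
  fun_prop

/-- The second order Taylor remainder of `exp(i y·ξ)`, with the soft truncation. -/
noncomputable def taylorRem (ξ y : E d) : ℂ :=
  Complex.exp (Complex.I * (inner ℝ y ξ : ℝ)) - 1 - Complex.I * (inner ℝ ξ (softTrunc y) : ℝ)
    + (1 / 2 : ℂ) * ((inner ℝ ξ (softTrunc y) : ℝ) : ℂ) ^ 2

@[fun_prop]
theorem continuous_taylorRem (ξ : E d) : Continuous (taylorRem ξ) := by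
  unfold taylorRem
  fun_prop

theorem norm_taylorRem_le (ξ y : E d) : ‖taylorRem ξ y‖ ≤ 2 + ‖ξ‖ + ‖ξ‖ ^ 2 := by
  have h1 : |(inner ℝ ξ (softTrunc y) : ℝ)| ≤ ‖ξ‖ := by
    refine (abs_real_inner_le_norm _ _).trans ?_
    exact mul_le_of_le_one_right (norm_nonneg _) (norm_softTrunc_le_one y)
  have h2 : ‖Complex.exp (Complex.I * (inner ℝ y ξ : ℝ))‖ = 1 := by
    rw [mul_comm, Complex.norm_exp_ofReal_mul_I]
  unfold taylorRem
  refine (norm_add_le _ _).trans (add_le_add ((norm_sub_le _ _).trans (add_le_add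
    ((norm_sub_le _ _).trans ?_) ?_)) ?_)
  · rw [h2]; norm_num
  · simpa using h1
  · rw [norm_mul, norm_pow, Complex.norm_real, Real.norm_eq_abs]
    have : |(inner ℝ ξ (softTrunc y) : ℝ)| ^ 2 ≤ ‖ξ‖ ^ 2 := by gcongr
    rw [sq_abs] at this
    norm_num
    nlinarith [sq_nonneg ‖ξ‖]

/-- The remainder is of third order in `y` while `gaussGap` is of exact second order, which leaves a
factor `‖y‖`. -/
theorem norm_taylorRem_le_near (ξ y : E d) (hy : ‖y‖ ≤ 1) (hξ : ‖y‖ * ‖ξ‖ ≤ 1) :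
    ‖taylorRem ξ y‖ ≤ gaussGap y * ((4 * ‖ξ‖ ^ 3 + ‖ξ‖ + ‖ξ‖ ^ 2) * ‖y‖) := by
  set θ : ℝ := inner ℝ y ξ with hθ
  set e : ℝ := Real.exp (-‖y‖ ^ 2 / 2) with he
  have hG : gaussGap y = 1 - e := rfl
  have hG0 := gaussGap_nonneg y
  have he0 : 0 < e := Real.exp_pos _
  have hin : (inner ℝ ξ (softTrunc y) : ℝ) = e * θ := by
    rw [softTrunc, real_inner_smul_right, real_inner_comm]
  have hle : |θ| ≤ ‖y‖ * ‖ξ‖ := abs_real_inner_le_norm _ _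
  have hn : ‖Complex.I * (θ : ℂ)‖ = |θ| := by simp
  have h1 := Complex.exp_bound (x := Complex.I * θ) (by rw [hn]; exact hle.trans hξ) (n := 3)
    (by norm_num)
  rw [hn] at h1
  have hsum : ∑ m ∈ Finset.range 3, (Complex.I * (θ : ℂ)) ^ m / (m.factorial : ℂ)
      = 1 + Complex.I * θ - (1 / 2 : ℂ) * (θ : ℂ) ^ 2 := by
    simp only [Finset.sum_range_succ, Finset.sum_range_zero, mul_pow, Complex.I_sq]
    norm_num [Nat.factorial]
    ring
  rw [hsum] at h1
  -- The genuine Taylor remainder at `iθ`, plus the error of replacing `θ` by `eθ`; both error terms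
  -- contain the factor `1 - e = gaussGap y`.
  have hdec : taylorRem ξ y = (Complex.exp (Complex.I * θ)
      - (1 + Complex.I * θ - (1 / 2 : ℂ) * (θ : ℂ) ^ 2))
      + (Complex.I * ((θ * (1 - e) : ℝ) : ℂ) - ((1 / 2 * θ ^ 2 * ((1 - e) * (1 + e)) : ℝ) : ℂ)) := by
    rw [taylorRem, hin, ← hθ]
    push_cast
    ring
  have hc : ((Nat.succ 3 : ℕ) : ℝ) * ((Nat.factorial 3 : ℕ) * (3 : ℕ) : ℝ)⁻¹ ≤ 1 := by
    norm_num [Nat.factorial]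
  have h2 : |θ| ^ 3 ≤ ‖ξ‖ ^ 3 * ‖y‖ * (4 * gaussGap y) := by
    have h3 : ‖y‖ ^ 2 ≤ 4 * gaussGap y := by
      have := le_gaussGap y
      rwa [min_eq_right (pow_le_one₀ (norm_nonneg _) hy)] at this
    calc |θ| ^ 3 ≤ (‖y‖ * ‖ξ‖) ^ 3 := by gcongr
      _ = ‖ξ‖ ^ 3 * ‖y‖ * ‖y‖ ^ 2 := by ring
      _ ≤ _ := by gcongr
  have h4 : ‖Complex.I * ((θ * (1 - e) : ℝ) : ℂ)‖ ≤ ‖y‖ * ‖ξ‖ * gaussGap y := by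
    rw [norm_mul, Complex.norm_I, one_mul, Complex.norm_real, Real.norm_eq_abs, abs_mul, ← hG,
      abs_of_nonneg hG0]
    gcongr
  have h5 : ‖((1 / 2 * θ ^ 2 * ((1 - e) * (1 + e)) : ℝ) : ℂ)‖ ≤ ‖ξ‖ ^ 2 * ‖y‖ * gaussGap y := by
    have h6 : θ ^ 2 ≤ ‖ξ‖ ^ 2 * ‖y‖ := by
      calc θ ^ 2 = |θ| ^ 2 := (sq_abs _).symm
        _ ≤ (‖y‖ * ‖ξ‖) ^ 2 := by gcongr
        _ = ‖ξ‖ ^ 2 * (‖y‖ * ‖y‖) := by ring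
        _ ≤ ‖ξ‖ ^ 2 * (‖y‖ * 1) := by gcongr
        _ = _ := by ring
    rw [Complex.norm_real, Real.norm_of_nonneg (by rw [← hG]; positivity), ← hG]
    have h7 : 1 / 2 * (1 + e) ≤ 1 := by linarith
    calc 1 / 2 * θ ^ 2 * (gaussGap y * (1 + e)) = θ ^ 2 * gaussGap y * (1 / 2 * (1 + e)) := by ring
      _ ≤ (‖ξ‖ ^ 2 * ‖y‖) * gaussGap y * 1 := by gcongr
      _ = _ := by ring
  rw [hdec]
  calc _ ≤ |θ| ^ 3 * 1 + (‖y‖ * ‖ξ‖ * gaussGap y + ‖ξ‖ ^ 2 * ‖y‖ * gaussGap y) := by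
        refine (norm_add_le _ _).trans (add_le_add (h1.trans ?_)
          ((norm_sub_le _ _).trans (add_le_add h4 h5)))
        gcongr
    _ ≤ ‖ξ‖ ^ 3 * ‖y‖ * (4 * gaussGap y) + (‖y‖ * ‖ξ‖ * gaussGap y + ‖ξ‖ ^ 2 * ‖y‖ * gaussGap y) := by
        linarith
    _ = _ := by ring

/-- The quotient of the Taylor remainder and `1 - exp(-|y|² / 2)`; it vanishes at the origin. -/
noncomputable def taylorQuot (ξ y : E d) : ℂ := taylorRem ξ y / (gaussGap y : ℂ)

theorem taylorQuot_zero (ξ : E d) : taylorQuot ξ 0 = 0 := by simp [taylorQuot]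

theorem norm_taylorQuot_eq (ξ y : E d) : ‖taylorQuot ξ y‖ = ‖taylorRem ξ y‖ / gaussGap y := by
  rw [taylorQuot, norm_div, Complex.norm_real, Real.norm_of_nonneg (gaussGap_nonneg y)]

/-- Continuity at the origin, with value `0`, makes the quotient an admissible test function for
weak convergence and blind to any mass collecting at the origin. -/
theorem continuous_taylorQuot (ξ : E d) : Continuous (taylorQuot ξ) := by
  rw [continuous_iff_continuousAt]
  intro y
  rcases eq_or_ne y 0 with rfl | hy
  · rw [ContinuousAt, taylorQuot_zero]
    set K := 4 * ‖ξ‖ ^ 3 + ‖ξ‖ + ‖ξ‖ ^ 2 with hK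
    refine squeeze_zero_norm' (a := fun y : E d => K * ‖y‖) ?_ ?_
    · have h1 : ∀ᶠ y : E d in 𝓝 0, ‖y‖ < 1 :=
        continuous_norm.continuousAt.eventually_lt_const (by simp)
      have h2 : ∀ᶠ y : E d in 𝓝 0, ‖y‖ * ‖ξ‖ < 1 :=
        (Continuous.tendsto' (f := fun y : E d => ‖y‖ * ‖ξ‖) (by fun_prop) 0 0
          (by simp)).eventually_lt_const one_pos
      filter_upwards [h1, h2] with y hy1 hy2
      rw [norm_taylorQuot_eq]
      refine div_le_of_le_mul₀ (gaussGap_nonneg y) (by positivity) ?_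
      rw [mul_comm]
      exact norm_taylorRem_le_near ξ y hy1.le hy2.le
    · exact (Continuous.tendsto' (by fun_prop) _ _ (by simp))
  · refine (continuous_taylorRem ξ).continuousAt.div ?_ ?_
    · fun_prop
    · exact_mod_cast (gaussGap_pos hy).ne'

theorem exists_norm_taylorQuot_le (ξ : E d) : ∃ C : ℝ, ∀ y, ‖taylorQuot ξ y‖ ≤ C := by
  obtain ⟨M, hM⟩ := (isCompact_closedBall (0 : E d) 1).exists_bound_of_continuousOn
    (continuous_taylorQuot ξ).continuousOn
  refine ⟨max M (4 * (2 + ‖ξ‖ + ‖ξ‖ ^ 2)), fun y => ?_⟩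
  rcases le_total ‖y‖ 1 with h | h
  · exact (hM y (by simpa using h)).trans (le_max_left _ _)
  · refine le_trans ?_ (le_max_right _ _)
    rw [norm_taylorQuot_eq]
    have h1 := le_gaussGap y
    rw [min_eq_left (one_le_pow₀ h)] at h1
    refine div_le_of_le_mul₀ (gaussGap_nonneg y) (by positivity) ((norm_taylorRem_le ξ y).trans ?_)
    nlinarith [norm_nonneg ξ, sq_nonneg ‖ξ‖]

/-- `taylorQuot ξ` as a bounded continuous function. -/
noncomputable def taylorQuotBCF (ξ : E d) : BoundedContinuousFunction (E d) ℂ :=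
  BoundedContinuousFunction.ofNormedAddCommGroup (taylorQuot ξ) (continuous_taylorQuot ξ)
    (exists_norm_taylorQuot_le ξ).choose (exists_norm_taylorQuot_le ξ).choose_spec

theorem taylorQuot_mul_gaussGap (ξ y : E d) : taylorQuot ξ y * gaussGap y = taylorRem ξ y := by
  rcases eq_or_ne y 0 with rfl | hy
  · simp [taylorRem, softTrunc]
  · rw [taylorQuot, div_mul_cancel₀]
    exact_mod_cast (gaussGap_pos hy).ne'

/-! ### Lévy measures -/

variable {ν : Measure (E d)}

theorem IsLevyMeasure.integrable_weight (hν : IsLevyMeasure ν) :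
    Integrable (fun y : E d => min 1 (‖y‖ ^ 2)) ν := by
  refine ⟨by fun_prop, ?_⟩
  rw [hasFiniteIntegral_iff_ofReal (.of_forall fun y => by positivity)]
  exact hν.2

theorem IsLevyMeasure.integrable_of_norm_le (hν : IsLevyMeasure ν) {F : Type*}
    [NormedAddCommGroup F] {f : E d → F} (hf : AEStronglyMeasurable f ν) (C : ℝ)
    (h : ∀ y, ‖f y‖ ≤ C * min 1 (‖y‖ ^ 2)) : Integrable f ν :=
  (hν.integrable_weight.const_mul C).mono' hf (.of_forall h)

/-- The weighted measure `min(1, |y|²) ν` is finite, and `ν` is recovered from it by the inverse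
density because it does not charge the origin, the only zero of the weight. Fubini needs this. -/
theorem IsLevyMeasure.sFinite (hν : IsLevyMeasure ν) : SFinite ν := by
  set f : E d → ENNReal := fun y => ENNReal.ofReal (min 1 (‖y‖ ^ 2)) with hf
  have hfm : Measurable f := by fun_prop
  have hfin : IsFiniteMeasure (ν.withDensity f) := isFiniteMeasure_withDensity hν.2.ne
  have h0 : ∀ᵐ y ∂ν, f y ≠ 0 := by
    have : ∀ᵐ y ∂ν, y ≠ 0 := by
      rw [ae_iff]; simpa using hν.1
    filter_upwards [this] with y hy
    have : 0 < min 1 (‖y‖ ^ 2) := lt_min one_pos (by positivity)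
    simpa [hf] using hy
  have e := withDensity_inv_same hfm h0 (.of_forall fun y => ENNReal.ofReal_ne_top)
  rw [← e]
  infer_instance

theorem measurable_lkIntegrand (ξ : E d) : Measurable (lkIntegrand ξ) :=
  Measurable.of_uncurry_left measurable_uncurry_lkIntegrand

theorem IsLevyMeasure.integrable_lkIntegrand (hν : IsLevyMeasure ν) (ξ : E d) :
    Integrable (lkIntegrand ξ) ν :=
  hν.integrable_of_norm_le (measurable_lkIntegrand ξ).aestronglyMeasurable _ (norm_lkIntegrand_le ξ)

theorem IsLevyMeasure.exists_norm_levyKhintchine_le (hν : IsLevyMeasure ν) (l : E d)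
    (Q : Matrix (Fin d) (Fin d) ℝ) :
    ∃ C : ℝ, 0 ≤ C ∧ ∀ ξ, ‖levyKhintchine l Q ν ξ‖ ≤ C * (1 + ‖ξ‖ ^ 2) := by
  set W := ∫ y : E d, min 1 (‖y‖ ^ 2) ∂ν with hW
  have hW0 : 0 ≤ W := integral_nonneg fun y => by positivity
  set L := Matrix.toEuclideanCLM (n := Fin d) (𝕜 := ℝ) Q with hL
  have hin : ∀ ξ : E d, ξ.ofLp ⬝ᵥ Q *ᵥ ξ.ofLp = inner ℝ ξ (L ξ) := fun ξ => by
    rw [EuclideanSpace.inner_eq_star_dotProduct, dotProduct_comm]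
    simp [hL]
  refine ⟨‖l‖ + ‖L‖ + 3 * W, by positivity, fun ξ => ?_⟩
  have h1 : ‖Complex.I * ((inner ℝ l ξ : ℝ) : ℂ)‖ ≤ ‖l‖ * (1 + ‖ξ‖ ^ 2) := by
    rw [norm_mul, Complex.norm_I, one_mul, Complex.norm_real]
    refine (norm_inner_le_norm _ _).trans ?_
    gcongr
    nlinarith [sq_nonneg (‖ξ‖ - 1)]
  have h2 : ‖(1 / 2 : ℂ) * ((ξ.ofLp ⬝ᵥ Q *ᵥ ξ.ofLp : ℝ) : ℂ)‖ ≤ ‖L‖ * (1 + ‖ξ‖ ^ 2) := by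
    rw [hin, norm_mul, Complex.norm_real]
    have h3 : ‖(inner ℝ ξ (L ξ) : ℝ)‖ ≤ ‖ξ‖ * (‖L‖ * ‖ξ‖) :=
      (norm_inner_le_norm _ _).trans (by gcongr; exact L.le_opNorm ξ)
    norm_num
    have h4 : ‖ξ‖ * (‖L‖ * ‖ξ‖) = ‖L‖ * ‖ξ‖ ^ 2 := by ring
    rw [Real.norm_eq_abs] at h3
    have h5 : 0 ≤ ‖L‖ * ‖ξ‖ ^ 2 := by positivity
    nlinarith [norm_nonneg L]
  have h3 : ‖∫ y, lkIntegrand ξ y ∂ν‖ ≤ 3 * W * (1 + ‖ξ‖ ^ 2) := by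
    refine (norm_integral_le_of_norm_le (hν.integrable_weight.const_mul _)
      (.of_forall (norm_lkIntegrand_le ξ))).trans_eq ?_
    rw [integral_const_mul]
    ring
  unfold levyKhintchine
  refine (norm_add₃_le).trans ?_
  rw [norm_neg]
  linarith

theorem IsLevyMeasure.continuous_levyKhintchine (hν : IsLevyMeasure ν) (l : E d)
    (Q : Matrix (Fin d) (Fin d) ℝ) : Continuous (levyKhintchine l Q ν) := by
  have h : Continuous fun ξ => ∫ y, lkIntegrand ξ y ∂ν := by
    rw [continuous_iff_continuousAt]
    intro ξ₀
    refine continuousAt_of_dominated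
      (bound := fun y => 3 * (1 + (‖ξ₀‖ + 1) ^ 2) * min 1 (‖y‖ ^ 2)) (.of_forall fun ξ =>
      (measurable_lkIntegrand ξ).aestronglyMeasurable) ?_ (hν.integrable_weight.const_mul _)
      (.of_forall fun y => (continuous_lkIntegrand_left y).continuousAt)
    filter_upwards [Metric.ball_mem_nhds ξ₀ one_pos] with ξ hξ
    refine .of_forall fun y => (norm_lkIntegrand_le ξ y).trans ?_
    have hξ' : ‖ξ‖ ≤ ‖ξ₀‖ + 1 := by
      rw [mem_ball_iff_norm] at hξ
      linarith [norm_le_norm_add_norm_sub' ξ ξ₀]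
    gcongr
  unfold levyKhintchine
  fun_prop

end Estimates

/-! ### Weak limits of finite measures -/

section WeakLimit

variable {d : ℕ}

/-- Finite measures whose characteristic functions converge to a function continuous at `0` and
nonzero there have a weak limit point. -/
theorem exists_weak_limit {ρ : ℕ → Measure (E d)} [∀ n, IsFiniteMeasure (ρ n)]
    (hρ : ∀ n, ρ n ≠ 0) {f : E d → ℂ} (hf : ContinuousAt f 0) (hf0 : f 0 ≠ 0)
    (h : ∀ η, Tendsto (fun n => charFun (ρ n) η) atTop (𝓝 (f η))) :
    ∃ (U : Filter ℕ) (ρ' : Measure (E d)), U.NeBot ∧ U ≤ atTop ∧ IsFiniteMeasure ρ' ∧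
      ∀ g : BoundedContinuousFunction (E d) ℂ,
        Tendsto (fun n => ∫ y, g y ∂(ρ n)) U (𝓝 (∫ y, g y ∂ρ')) := by
  have hc0 : ∀ n, (ρ n).real Set.univ ≠ 0 := fun n => by
    rw [Ne, measureReal_eq_zero_iff]
    simpa using hρ n
  have hne : ∀ n, NeZero (ρ n) := fun n => ⟨hρ n⟩
  let π : ℕ → ProbabilityMeasure (E d) := fun n =>
    ⟨((ρ n) Set.univ)⁻¹ • ρ n, isProbabilityMeasureSMul⟩
  have hint : ∀ n (g : E d → ℂ),
      ∫ y, g y ∂(π n : Measure (E d)) = (((ρ n).real Set.univ : ℝ) : ℂ)⁻¹ * ∫ y, g y ∂(ρ n) := by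
    intro n g
    change ∫ y, g y ∂(((ρ n) Set.univ)⁻¹ • ρ n) = _
    rw [integral_smul_measure, ENNReal.toReal_inv, Complex.real_smul]
    simp [Measure.real]
  have hmass : Tendsto (fun n => (((ρ n).real Set.univ : ℝ) : ℂ)) atTop (𝓝 (f 0)) := by
    refine (h 0).congr fun n => ?_
    rw [charFun_zero]
  have hchar : ∀ η, Tendsto (fun n => charFun (π n : Measure (E d)) η) atTop
      (𝓝 ((f 0)⁻¹ * f η)) := by
    intro η
    refine ((hmass.inv₀ hf0).mul (h η)).congr fun n => ?_
    rw [charFun_apply, charFun_apply, hint]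
  -- Continuity of the limit at `0` enters here: it prevents mass from escaping to infinity.
  have htight : IsTightMeasureSet (Set.range fun n => (π n : Measure (E d))) :=
    isTightMeasureSet_of_tendsto_charFun (f := fun η => (f 0)⁻¹ * f η)
      (continuousAt_const.mul hf) hchar
  have hcompact : IsCompact (closure (Set.range π)) :=
    isCompact_closure_of_isTightMeasureSet (by
      convert htight using 1
      ext μ
      simp)
  -- A free ultrafilter replaces a convergent subsequence.
  obtain ⟨π', -, hπ'⟩ := hcompact.ultrafilter_le_nhds ((hyperfilter ℕ).map π)
    (le_principal_iff.mpr (mem_of_superset (image_mem_map univ_mem)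
      (by rw [Set.image_univ]; exact subset_closure)))
  have hU : ((hyperfilter ℕ : Ultrafilter ℕ) : Filter ℕ) ≤ atTop := by
    rw [← Nat.cofinite_eq_atTop]; exact hyperfilter_le_cofinite
  have hπ'' : Tendsto π (hyperfilter ℕ : Ultrafilter ℕ) (𝓝 π') := hπ'
  rw [ProbabilityMeasure.tendsto_iff_forall_integral_rclike_tendsto ℂ] at hπ''
  -- As a limit of total masses, `f 0` is a nonnegative real, so the limit law can be rescaled by it
  -- to undo the normalisation.
  have hre : 0 ≤ (f 0).re := by
    refine ge_of_tendsto ((Complex.continuous_re.tendsto _).comp hmass) (.of_forall fun n => ?_)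
    simp
  have him : (f 0).im = 0 := by
    refine tendsto_nhds_unique ((Complex.continuous_im.tendsto _).comp hmass) ?_
    simp [Function.comp_def]
  refine ⟨(hyperfilter ℕ : Ultrafilter ℕ), ENNReal.ofReal (f 0).re • (π' : Measure (E d)),
    inferInstance, hU, Measure.smul_finite _ ENNReal.ofReal_ne_top, fun g => ?_⟩
  rw [integral_smul_measure, ENNReal.toReal_ofReal hre, Complex.real_smul]
  have e : (((f 0).re : ℝ) : ℂ) = f 0 := Complex.ext (by simp) (by simp [him])
  rw [e]
  refine ((hmass.mono_left hU).mul (hπ'' g)).congr fun n => ?_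
  rw [hint, mul_inv_cancel_left₀]
  exact_mod_cast hc0 n

end WeakLimit

/-! ### The rescaled jump laws -/

section Rescaled

variable {d : ℕ}

/-- The measure `t⁻¹ (1 - exp(-|y|²/2)) μ(dy)`, together with a unit mass at the origin. -/
noncomputable def rescaled (μ : Measure (E d)) (t : ℝ) : Measure (E d) :=
  μ.withDensity (fun y => ENNReal.ofReal (gaussGap y / t)) + Measure.dirac 0

theorem rescaled_ne_zero (μ : Measure (E d)) (t : ℝ) : rescaled μ t ≠ 0 := by
  intro h
  have := congrArg (fun m : Measure (E d) => m {0}) h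
  simp [rescaled] at this

instance isFiniteMeasure_rescaled (μ : Measure (E d)) [IsFiniteMeasure μ] (t : ℝ) :
    IsFiniteMeasure (rescaled μ t) := by
  have h : IsFiniteMeasure (μ.withDensity (fun y => ENNReal.ofReal (gaussGap y / t))) := by
    refine isFiniteMeasure_withDensity_ofReal ?_
    refine (Integrable.div_const (Integrable.of_bound ?_ 1 (.of_forall fun y => ?_)) t).2
    · exact continuous_gaussGap.aestronglyMeasurable
    · rw [Real.norm_of_nonneg (gaussGap_nonneg y)]; exact gaussGap_le_one y
  unfold rescaled
  infer_instance

theorem integral_rescaled (μ : Measure (E d)) [IsFiniteMeasure μ] {t : ℝ} (ht : 0 ≤ t)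
    (g : BoundedContinuousFunction (E d) ℂ) :
    ∫ y, g y ∂(rescaled μ t) = (∫ y, g y * gaussGap y ∂μ) / (t : ℂ) + g 0 := by
  have h1 : Integrable g (rescaled μ t) := g.integrable _
  unfold rescaled at h1 ⊢
  rw [integral_add_measure h1.left_of_add_measure h1.right_of_add_measure, integral_dirac,
    integral_withDensity_eq_integral_toReal_smul (by fun_prop)
      (.of_forall fun y => ENNReal.ofReal_lt_top), ← integral_div]
  congr 1
  refine integral_congr_ae (.of_forall fun y => ?_)
  simp only
  rw [ENNReal.toReal_ofReal (div_nonneg (gaussGap_nonneg y) ht), Complex.real_smul]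
  push_cast
  ring

theorem cexp_neg_sq_eq (y : E d) : Complex.exp (-(‖y‖ : ℂ) ^ 2 / 2) = 1 - (gaussGap y : ℂ) := by
  unfold gaussGap
  push_cast
  ring

/-- Since `exp(-|y|²/2)` is the characteristic function of a standard Gaussian, the weight `1 -
exp(-|y|²/2)` turns `φ` into `φ` minus its Gaussian average. Subtracting `1` in both terms cancels
and lets each converge as `t → 0`; the final `1` comes from the mass at the origin. -/
theorem charFun_rescaled (μ : Measure (E d)) [IsProbabilityMeasure μ] {t : ℝ} (ht : 0 ≤ t) (η : E d) :
    charFun (rescaled μ t) η = (charFun μ η - 1) / (t : ℂ)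
      - ∫ ξ, (charFun μ (η + ξ) - 1) / (t : ℂ) ∂(stdGaussian (E d)) + 1 := by
  have hG : Integrable (fun y : E d => Complex.exp ((inner ℝ y η : ℝ) * Complex.I)
      * (gaussGap y : ℂ)) μ := by
    refine Integrable.of_bound (by fun_prop) 1 (.of_forall fun y => ?_)
    rw [norm_mul, Complex.norm_exp_ofReal_mul_I, one_mul, Complex.norm_real,
      Real.norm_of_nonneg (gaussGap_nonneg y)]
    exact gaussGap_le_one y
  have hsplit : ∫ y, Complex.exp ((inner ℝ y η : ℝ) * Complex.I) * (gaussGap y : ℂ) ∂μ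
      = charFun μ η - ∫ ξ, charFun μ (η + ξ) ∂(stdGaussian (E d)) := by
    have h1 : ∀ y : E d, Complex.exp ((inner ℝ y η : ℝ) * Complex.I) * (gaussGap y : ℂ)
        = Complex.exp ((inner ℝ y η : ℝ) * Complex.I)
          - ∫ ξ, Complex.exp ((inner ℝ y (η + ξ) : ℝ) * Complex.I) ∂(stdGaussian (E d)) := by
      intro y
      have h2 := charFun_stdGaussian (E := E d) y
      rw [cexp_neg_sq_eq, charFun_apply] at h2
      have h3 : ∀ ξ : E d, Complex.exp ((inner ℝ y (η + ξ) : ℝ) * Complex.I)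
          = Complex.exp ((inner ℝ y η : ℝ) * Complex.I)
            * Complex.exp ((inner ℝ ξ y : ℝ) * Complex.I) := by
        intro ξ
        rw [← Complex.exp_add, inner_add_right, real_inner_comm ξ y]
        push_cast
        ring_nf
      simp_rw [h3]
      rw [integral_const_mul, h2]
      ring
    have h4 : Integrable (fun p : E d × E d =>
        Complex.exp ((inner ℝ p.1 (η + p.2) : ℝ) * Complex.I)) (μ.prod (stdGaussian (E d))) :=
      Integrable.of_bound (by fun_prop) 1 (.of_forall fun p => by
        rw [Complex.norm_exp_ofReal_mul_I])
    simp_rw [h1]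
    rw [integral_sub (integrable_cexp_inner μ η) h4.integral_prod_left,
      integral_integral_swap h4]
    simp only [charFun_apply]
  have hci : Integrable (fun ξ => charFun μ (η + ξ)) (stdGaussian (E d)) := by
    refine Integrable.of_bound ?_ 1 (.of_forall fun ξ => norm_charFun_le_one _)
    exact (continuous_charFun.comp (by fun_prop)).aestronglyMeasurable
  have h5 := integral_rescaled μ ht (BoundedContinuousFunction.innerProbChar η)
  simp only [BoundedContinuousFunction.innerProbChar_apply] at h5
  rw [charFun_apply, h5, hsplit, integral_div, integral_sub hci (integrable_const _)]
  simp
  ring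

end Rescaled

/-! ### Limits of linear and quadratic forms -/

section Forms

variable {d : ℕ}

/-- Convergence on the standard basis already determines the limit vector; no bound on `l n` is
needed. -/
theorem exists_inner_of_tendsto {U : Filter ℕ} [U.NeBot] {l : ℕ → E d} {A : E d → ℝ}
    (h : ∀ ξ, Tendsto (fun n => (inner ℝ ξ (l n) : ℝ)) U (𝓝 (A ξ))) :
    ∃ l' : E d, ∀ ξ, A ξ = inner ℝ ξ l' := by
  refine ⟨WithLp.toLp 2 fun j => A (EuclideanSpace.single j 1), fun ξ => ?_⟩
  refine tendsto_nhds_unique (h ξ) ?_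
  simp only [PiLp.inner_apply]
  refine tendsto_finsetSum _ fun j _ => ?_
  have := (h (EuclideanSpace.single j 1)).mul_const (ξ j)
  simpa [EuclideanSpace.inner_single_left] using this

theorem dotProduct_mulVec_eq_sum (Q : Matrix (Fin d) (Fin d) ℝ) (ξ : E d) :
    ξ.ofLp ⬝ᵥ Q *ᵥ ξ.ofLp = ∑ j, ∑ k, ξ j * ξ k * Q j k := by
  simp only [dotProduct, Matrix.mulVec, Finset.mul_sum]
  refine Finset.sum_congr rfl fun j _ => Finset.sum_congr rfl fun k _ => ?_
  ring

theorem exists_matrix_of_tendsto {U : Filter ℕ} [U.NeBot] {q : ℕ → Matrix (Fin d) (Fin d) ℝ}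
    (hq : ∀ n, (q n).IsSymm) {B : E d → ℝ}
    (h : ∀ ξ : E d, Tendsto (fun n => ξ.ofLp ⬝ᵥ q n *ᵥ ξ.ofLp) U (𝓝 (B ξ))) :
    ∃ Q : Matrix (Fin d) (Fin d) ℝ, Q.IsSymm ∧ ∀ ξ : E d, B ξ = ξ.ofLp ⬝ᵥ Q *ᵥ ξ.ofLp := by
  set e : Fin d → E d := fun j => EuclideanSpace.single j 1 with he
  set Q : Matrix (Fin d) (Fin d) ℝ :=
    Matrix.of fun j k => (B (e j + e k) - B (e j) - B (e k)) / 2 with hQ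
  -- Polarisation recovers the matrix entries from values of the quadratic form, so they converge as
  -- well.
  have hpol : ∀ n j k, q n j k = ((e j + e k).ofLp ⬝ᵥ q n *ᵥ (e j + e k).ofLp
      - (e j).ofLp ⬝ᵥ q n *ᵥ (e j).ofLp - (e k).ofLp ⬝ᵥ q n *ᵥ (e k).ofLp) / 2 := by
    intro n j k
    have hs : q n k j = q n j k := (hq n).apply j k
    simp only [he, WithLp.ofLp_add, PiLp.ofLp_single, Matrix.mulVec_add, add_dotProduct, dotProduct_add,
      Matrix.mulVec_single_one, single_one_dotProduct, Matrix.col_apply, hs]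
    ring
  have hlim : ∀ j k, Tendsto (fun n => q n j k) U (𝓝 (Q j k)) := by
    intro j k
    simp only [hpol _ j k]
    exact (((h _).sub (h _)).sub (h _)).div_const 2
  refine ⟨Q, ?_, fun ξ => tendsto_nhds_unique (h ξ) ?_⟩
  · ext j k
    simp only [Matrix.transpose_apply, hQ, Matrix.of_apply, add_comm (e k) (e j)]
    ring
  · simp only [dotProduct_mulVec_eq_sum]
    exact tendsto_finsetSum _ fun j _ => tendsto_finsetSum _ fun k _ => (hlim j k).const_mul _

end Forms

/-! ### The Lévy measure of a weak limit -/

section LevyMeasureOfLimit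

variable {d : ℕ}

/-- The measure `(1 - exp(-|y|²/2))⁻¹ ρ(dy)` away from the origin. -/
noncomputable def unweighted (ρ : Measure (E d)) : Measure (E d) :=
  (ρ.restrict {0}ᶜ).withDensity fun y => ENNReal.ofReal (gaussGap y)⁻¹

theorem isLevyMeasure_unweighted (ρ : Measure (E d)) [IsFiniteMeasure ρ] :
    IsLevyMeasure (unweighted ρ) := by
  refine ⟨?_, ?_⟩
  · refine withDensity_absolutelyContinuous _ _ ?_
    rw [Measure.restrict_apply (measurableSet_singleton 0)]
    simp
  · unfold unweighted
    rw [lintegral_withDensity_eq_lintegral_mul _ (by fun_prop) (by fun_prop)]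
    calc _ ≤ ∫⁻ _, ENNReal.ofReal 4 ∂(ρ.restrict {0}ᶜ) := by
          refine lintegral_mono fun y => ?_
          rw [Pi.mul_apply, ← ENNReal.ofReal_mul (inv_nonneg.mpr (gaussGap_nonneg y))]
          refine ENNReal.ofReal_le_ofReal ?_
          rw [inv_mul_eq_div]
          exact div_le_of_le_mul₀ (gaussGap_nonneg y) (by norm_num) (le_gaussGap y)
      _ < ⊤ := by
          rw [lintegral_const]
          exact ENNReal.mul_lt_top ENNReal.ofReal_lt_top (measure_lt_top _ _)

/-- Deleting the origin loses nothing because `taylorQuot ξ` vanishes there. -/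
theorem integral_unweighted (ρ : Measure (E d)) [IsFiniteMeasure ρ] (ξ : E d) :
    ∫ y, taylorRem ξ y ∂(unweighted ρ) = ∫ y, taylorQuot ξ y ∂ρ := by
  unfold unweighted
  rw [integral_withDensity_eq_integral_toReal_smul (by fun_prop)
    (.of_forall fun y => ENNReal.ofReal_lt_top)]
  rw [← setIntegral_eq_integral_of_forall_compl_eq_zero (s := {0}ᶜ) (f := taylorQuot ξ)]
  · refine integral_congr_ae (.of_forall fun y => ?_)
    simp only
    rw [ENNReal.toReal_ofReal (inv_nonneg.mpr (gaussGap_nonneg y)), Complex.real_smul, taylorQuot,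
      Complex.ofReal_inv, inv_mul_eq_div]
  · intro y hy
    have : y = 0 := by simpa using hy
    rw [this, taylorQuot_zero]

theorem integrable_inner_softTrunc_mul {ν : Measure (E d)} (hν : IsLevyMeasure ν) (j k : Fin d) :
    Integrable (fun y : E d => softTrunc y j * softTrunc y k) ν := by
  refine hν.integrable_of_norm_le (C := 1) ?_ fun y => ?_
  · exact Continuous.aestronglyMeasurable (by fun_prop)
  · rw [one_mul, norm_mul]
    refine le_trans ?_ (sq_norm_softTrunc_le y)
    rw [sq]
    exact mul_le_mul (PiLp.norm_apply_le _ j) (PiLp.norm_apply_le _ k) (norm_nonneg _)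
      (norm_nonneg _)

theorem sq_inner_eq_sum (ξ h : E d) :
    (inner ℝ ξ h : ℝ) ^ 2 = ∑ j, ∑ k, ξ j * ξ k * (h j * h k) := by
  rw [sq, PiLp.inner_apply, Finset.sum_mul_sum]
  refine Finset.sum_congr rfl fun j _ => Finset.sum_congr rfl fun k _ => ?_
  simp
  ring

/-- The matrix of second moments of the soft truncation. -/
noncomputable def secondMoments (ν : Measure (E d)) : Matrix (Fin d) (Fin d) ℝ :=
  Matrix.of fun j k => ∫ y, softTrunc y j * softTrunc y k ∂ν

theorem isSymm_secondMoments (ν : Measure (E d)) : (secondMoments ν).IsSymm := by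
  ext j k
  simp only [secondMoments, Matrix.transpose_apply, Matrix.of_apply]
  simp only [mul_comm]

theorem integral_sq_inner_softTrunc {ν : Measure (E d)}
    (hν : ∀ j k, Integrable (fun y : E d => softTrunc y j * softTrunc y k) ν) (ξ : E d) :
    ∫ y, (inner ℝ ξ (softTrunc y) : ℝ) ^ 2 ∂ν = ξ.ofLp ⬝ᵥ secondMoments ν *ᵥ ξ.ofLp := by
  simp only [sq_inner_eq_sum, dotProduct_mulVec_eq_sum]
  rw [integral_finsetSum _ fun j _ => integrable_finsetSum _ fun k _ => (hν j k).const_mul _]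
  refine Finset.sum_congr rfl fun j _ => ?_
  rw [integral_finsetSum _ fun k _ => (hν j k).const_mul _]
  refine Finset.sum_congr rfl fun k _ => ?_
  rw [integral_const_mul]
  rfl

/-- This converts to the sharp truncation: the difference of the truncations becomes a drift term,
the quadratic term a matrix of second moments. -/
theorem integral_taylorRem {ν : Measure (E d)} (hν : IsLevyMeasure ν) (ξ : E d) :
    ∫ y, taylorRem ξ y ∂ν = -(∫ y, lkIntegrand ξ y ∂ν)
      + Complex.I * (inner ℝ ξ (∫ y, (trunc y • y - softTrunc y) ∂ν) : ℝ)
      + (1 / 2 : ℂ) * ((ξ.ofLp ⬝ᵥ secondMoments ν *ᵥ ξ.ofLp : ℝ) : ℂ) := by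
  have hi1 : Integrable (fun y : E d => trunc y • y - softTrunc y) ν :=
    hν.integrable_of_norm_le (C := 1) (Measurable.aestronglyMeasurable (by fun_prop)) fun y => by
      rw [one_mul]; exact norm_trunc_smul_sub_softTrunc_le y
  have hi2 : Integrable (fun y : E d => (inner ℝ ξ (trunc y • y - softTrunc y) : ℝ)) ν :=
    hi1.const_inner ξ
  have hi3 : Integrable (fun y : E d => (inner ℝ ξ (softTrunc y) : ℝ) ^ 2) ν := by
    simp only [sq_inner_eq_sum]
    exact integrable_finsetSum _ fun j _ => integrable_finsetSum _ fun k _ =>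
      (integrable_inner_softTrunc_mul hν j k).const_mul _
  rw [← integral_sq_inner_softTrunc (integrable_inner_softTrunc_mul hν), ← integral_inner hi1,
    ← integral_complex_ofReal, ← integral_complex_ofReal, ← integral_const_mul,
    ← integral_const_mul, ← integral_neg, ← integral_add, ← integral_add]
  · refine integral_congr_ae (.of_forall fun y => ?_)
    simp only [taylorRem, lkIntegrand, inner_sub_right, real_inner_smul_right]
    push_cast
    ring
  · exact (hν.integrable_lkIntegrand ξ).neg.add (hi2.ofReal.const_mul _)
  · exact hi3.ofReal.const_mul _
  · exact (hν.integrable_lkIntegrand ξ).neg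
  · exact hi2.ofReal.const_mul _

theorem tendsto_natCast_inv_sq : Tendsto (fun n : ℕ => 2 / ((n : ℝ) + 1) ^ 2) atTop (𝓝 0) := by
  have h : Tendsto (fun n : ℕ => 2 * (1 / ((n : ℝ) + 1)) ^ 2) atTop (𝓝 (2 * 0 ^ 2)) :=
    ((tendsto_one_div_add_atTop_nhds_zero_nat (𝕜 := ℝ)).pow 2).const_mul 2
  simp only [ne_eq, OfNat.ofNat_ne_zero, not_false_eq_true, zero_pow, mul_zero] at h
  refine h.congr fun n => ?_
  rw [div_pow]; ring

/-- The Gaussian part is nonnegative if the real part of the exponent is. -/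
theorem posSemidef_of_re_levyKhintchine_nonneg {ν : Measure (E d)} (hν : IsLevyMeasure ν) (l : E d)
    {Q : Matrix (Fin d) (Fin d) ℝ} (hQ : Q.IsSymm) (h : ∀ ξ, 0 ≤ (levyKhintchine l Q ν ξ).re) :
    Q.PosSemidef := by
  refine Matrix.PosSemidef.of_dotProduct_mulVec_nonneg ?_ fun x => ?_
  · rw [Matrix.IsHermitian, Matrix.conjTranspose_eq_transpose_of_trivial]
    exact hQ
  set ξ : E d := WithLp.toLp 2 x with hξ
  have hre : ∀ η : E d, (levyKhintchine l Q ν η).re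
      = 1 / 2 * (η.ofLp ⬝ᵥ Q *ᵥ η.ofLp) + (∫ y, lkIntegrand η y ∂ν).re := by
    intro η
    unfold levyKhintchine
    have : ((1 / 2 : ℂ) * ((η.ofLp ⬝ᵥ Q *ᵥ η.ofLp : ℝ) : ℂ))
      = ((1 / 2 * (η.ofLp ⬝ᵥ Q *ᵥ η.ofLp) : ℝ) : ℂ) := by push_cast; ring
    rw [this, Complex.add_re, Complex.add_re, Complex.ofReal_re]
    simp
  have hlk : ∀ (s : ℝ) (y : E d), ‖(lkIntegrand (s • ξ) y).re‖ ≤ 2 := by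
    intro s y
    have : (lkIntegrand (s • ξ) y).re = 1 - Real.cos (inner ℝ y (s • ξ)) := by
      unfold lkIntegrand
      rw [mul_assoc, ← Complex.ofReal_mul, mul_comm Complex.I, Complex.add_re, Complex.sub_re,
        Complex.exp_ofReal_mul_I_re]
      simp
    rw [this, Real.norm_of_nonneg (by linarith [Real.cos_le_one (inner ℝ y (s • ξ))])]
    linarith [Real.neg_one_le_cos (inner ℝ y (s • ξ))]
  have hre_int : ∀ η : E d, (∫ y, lkIntegrand η y ∂ν).re = ∫ y, (lkIntegrand η y).re ∂ν := fun η =>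
    (integral_re (hν.integrable_lkIntegrand η)).symm
  -- Along `(n + 1)ξ` the Gaussian part grows like `(n + 1)²`, while the jump part divided by `(n +
  -- 1)²` tends to zero: pointwise because `1 - cos ≤ 2`, and dominated by the Lévy weight since `n
  -- + 1 ≥ 1`.
  have hlim : Tendsto (fun n : ℕ => ∫ y, (lkIntegrand (((n : ℝ) + 1) • ξ) y).re / ((n : ℝ) + 1) ^ 2 ∂ν)
      atTop (𝓝 (∫ _, (0 : ℝ) ∂ν)) := by
    refine tendsto_integral_of_dominated_convergence
      (fun y => 3 * (1 + ‖ξ‖ ^ 2) * min 1 (‖y‖ ^ 2)) (fun n => ?_) (hν.integrable_weight.const_mul _)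
      (fun n => .of_forall fun y => ?_) (.of_forall fun y => ?_)
    · exact ((Complex.measurable_re.comp (measurable_lkIntegrand _)).div_const
        _).aestronglyMeasurable
    · rw [norm_div, Real.norm_of_nonneg (by positivity : (0 : ℝ) ≤ ((n : ℝ) + 1) ^ 2)]
      refine div_le_of_le_mul₀ (by positivity) (by positivity) ?_
      refine (Complex.abs_re_le_norm _).trans ((norm_lkIntegrand_le _ y).trans ?_)
      rw [norm_smul, mul_pow, Real.norm_of_nonneg (by positivity : (0 : ℝ) ≤ (n : ℝ) + 1)]
      have h1 : (1 : ℝ) ≤ ((n : ℝ) + 1) ^ 2 := one_le_pow₀ (by linarith [n.cast_nonneg (α := ℝ)])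
      have h2 : 0 ≤ min 1 (‖y‖ ^ 2) := by positivity
      calc _ ≤ 3 * (((n : ℝ) + 1) ^ 2 + ((n : ℝ) + 1) ^ 2 * ‖ξ‖ ^ 2) * min 1 (‖y‖ ^ 2) := by gcongr
        _ = _ := by ring
    · refine squeeze_zero_norm (fun n => ?_) tendsto_natCast_inv_sq
      rw [norm_div, Real.norm_of_nonneg (by positivity : (0 : ℝ) ≤ ((n : ℝ) + 1) ^ 2)]
      exact div_le_div_of_nonneg_right (hlk _ y) (by positivity)
  rw [integral_zero] at hlim
  have hlim2 := hlim.const_add (1 / 2 * (ξ.ofLp ⬝ᵥ Q *ᵥ ξ.ofLp))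
  have hge : 0 ≤ 1 / 2 * (ξ.ofLp ⬝ᵥ Q *ᵥ ξ.ofLp) + 0 := by
    refine ge_of_tendsto' hlim2 fun n => ?_
    have h0 := h (((n : ℝ) + 1) • ξ)
    rw [hre, hre_int, WithLp.ofLp_smul, Matrix.mulVec_smul, smul_dotProduct, dotProduct_smul] at h0
    rw [integral_div]
    have hp : (0 : ℝ) < ((n : ℝ) + 1) ^ 2 := by positivity
    have e : 1 / 2 * (ξ.ofLp ⬝ᵥ Q *ᵥ ξ.ofLp)
        + (∫ y, (lkIntegrand (((n : ℝ) + 1) • ξ) y).re ∂ν) / ((n : ℝ) + 1) ^ 2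
        = (1 / 2 * (((n : ℝ) + 1) • ((n : ℝ) + 1) • (ξ.ofLp ⬝ᵥ Q *ᵥ ξ.ofLp))
        + ∫ y, (lkIntegrand (((n : ℝ) + 1) • ξ) y).re ∂ν) / ((n : ℝ) + 1) ^ 2 := by
      simp only [smul_eq_mul]
      field_simp
    rw [e]
    exact div_nonneg h0 hp.le
  have : star x = x := by ext; simp
  rw [this]
  simpa [hξ] using hge

end LevyMeasureOfLimit

/-! ### Existence of the Lévy triplet -/

section Existence

variable {Ω : Type*} [MeasurableSpace Ω] {P : Measure Ω} [IsProbabilityMeasure P]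
  {d : ℕ} {X : ℝ≥0 → Ω → E d} {ψ : E d → ℂ}

theorem integrable_sq_norm_stdGaussian : Integrable (fun ξ : E d => ‖ξ‖ ^ 2) (stdGaussian (E d)) := by
  have h : MemLp id 2 (stdGaussian (E d)) := IsGaussian.memLp_two_id
  simpa using h.integrable_norm_pow (by norm_num)

theorem IsCharacteristicExponent.norm_charFun_sub_one_div_le (hψ : IsCharacteristicExponent X P ψ)
    (hX : IsLevyProcess X P) (t : ℝ≥0) (ξ : E d) :
    ‖(charFun (P.map (X t)) ξ - 1) / ((t : ℝ) : ℂ)‖ ≤ ‖ψ ξ‖ := by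
  rw [hψ.charFun_eq hX]
  exact norm_exp_sub_one_div_le (hψ.re_nonneg hX ξ) t

theorem one_add_norm_add_sq_le (η ξ : E d) :
    1 + ‖η + ξ‖ ^ 2 ≤ 1 + 2 * ‖η‖ ^ 2 + 2 * ‖ξ‖ ^ 2 := by
  have : ‖η + ξ‖ ^ 2 ≤ (‖η‖ + ‖ξ‖) ^ 2 := by gcongr; exact norm_add_le _ _
  nlinarith [sq_nonneg (‖η‖ - ‖ξ‖)]

/-- Dominated convergence: the quotients are bounded by `|ψ|`, which grows at most quadratically,
and the Gaussian has second moments. -/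
theorem IsCharacteristicExponent.tendsto_charFun_rescaled (hψ : IsCharacteristicExponent X P ψ)
    (hX : IsLevyProcess X P) (η : E d) :
    Tendsto (fun t : ℝ≥0 => charFun (rescaled (P.map (X t)) t) η) (𝓝[>] 0)
      (𝓝 (-ψ η - (∫ ξ, -ψ (η + ξ) ∂(stdGaussian (E d))) + 1)) := by
  obtain ⟨C, hC0, hC⟩ := hψ.exists_norm_le hX
  have h : Tendsto (fun t : ℝ≥0 => (charFun (P.map (X t)) η - 1) / ((t : ℝ) : ℂ)
      - (∫ ξ, (charFun (P.map (X t)) (η + ξ) - 1) / ((t : ℝ) : ℂ) ∂(stdGaussian (E d))) + 1) (𝓝[>] 0)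
      (𝓝 (-ψ η - (∫ ξ, -ψ (η + ξ) ∂(stdGaussian (E d))) + 1)) := by
    refine ((hψ.tendsto_charFun hX η).sub ?_).add_const 1
    refine tendsto_integral_filter_of_dominated_convergence
      (fun ξ => C * (1 + 2 * ‖η‖ ^ 2 + 2 * ‖ξ‖ ^ 2)) (.of_forall fun t => ?_)
      (.of_forall fun t => .of_forall fun ξ => ?_) ?_
      (.of_forall fun ξ => hψ.tendsto_charFun hX _)
    · have := hX.isProbabilityMeasure_map t
      have hc : Continuous (charFun (P.map (X t))) := continuous_charFun
      exact Continuous.aestronglyMeasurable (by fun_prop)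
    · exact (hψ.norm_charFun_sub_one_div_le hX t _).trans ((hC _).trans
        (mul_le_mul_of_nonneg_left (one_add_norm_add_sq_le η ξ) hC0))
    · exact ((integrable_const _).add (integrable_sq_norm_stdGaussian.const_mul 2)).const_mul C
  refine h.congr fun t => ?_
  have := hX.isProbabilityMeasure_map t
  rw [charFun_rescaled _ t.coe_nonneg]

theorem IsCharacteristicExponent.continuous_gaussian_average (hψ : IsCharacteristicExponent X P ψ)
    (hX : IsLevyProcess X P) :
    ContinuousAt (fun η => -ψ η - (∫ ξ, -ψ (η + ξ) ∂(stdGaussian (E d))) + 1) 0 := by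
  obtain ⟨C, hC0, hC⟩ := hψ.exists_norm_le hX
  have hψc := hψ.1
  refine (hψc.neg.continuousAt.sub ?_).add continuousAt_const
  refine continuousAt_of_dominated (bound := fun ξ => C * (1 + 2 * 1 ^ 2 + 2 * ‖ξ‖ ^ 2))
    (.of_forall fun η => Continuous.aestronglyMeasurable (by fun_prop)) ?_
    (((integrable_const _).add (integrable_sq_norm_stdGaussian.const_mul 2)).const_mul C)
    (.of_forall fun ξ => Continuous.continuousAt (by fun_prop))
  filter_upwards [Metric.ball_mem_nhds (0 : E d) one_pos] with η hη
  refine .of_forall fun ξ => ?_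
  have hη' : ‖η‖ ≤ 1 := by simpa using (mem_ball_zero_iff.mp hη).le
  rw [norm_neg]
  refine (hC _).trans (mul_le_mul_of_nonneg_left ((one_add_norm_add_sq_le η ξ).trans ?_) hC0)
  gcongr

/-- The definition of `taylorRem`, integrated against `μ` and divided by `t`. The Dirac mass in
`rescaled` is invisible since `taylorQuot ξ 0 = 0`. -/
theorem charFun_sub_one_div_eq (μ : Measure (E d)) [IsProbabilityMeasure μ] {t : ℝ} (ht : 0 ≤ t)
    (ξ : E d) :
    (charFun μ ξ - 1) / (t : ℂ) = Complex.I * (inner ℝ ξ (t⁻¹ • ∫ y, softTrunc y ∂μ) : ℝ)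
      - (1 / 2 : ℂ) * ((ξ.ofLp ⬝ᵥ (t⁻¹ • secondMoments μ) *ᵥ ξ.ofLp : ℝ) : ℂ)
      + ∫ y, taylorQuot ξ y ∂(rescaled μ t) := by
  have hi1 : Integrable (softTrunc (d := d)) μ :=
    Integrable.of_bound continuous_softTrunc.aestronglyMeasurable 1
      (.of_forall norm_softTrunc_le_one)
  have hi2 : Integrable (fun y : E d => (inner ℝ ξ (softTrunc y) : ℝ)) μ := hi1.const_inner ξ
  have hi4 : ∀ j k, Integrable (fun y : E d => softTrunc y j * softTrunc y k) μ := by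
    intro j k
    refine Integrable.of_bound (Continuous.aestronglyMeasurable (by fun_prop)) 1
      (.of_forall fun y => ?_)
    rw [norm_mul]
    exact mul_le_one₀ ((PiLp.norm_apply_le _ j).trans (norm_softTrunc_le_one y)) (norm_nonneg _)
      ((PiLp.norm_apply_le _ k).trans (norm_softTrunc_le_one y))
  have hi3 : Integrable (fun y : E d => (inner ℝ ξ (softTrunc y) : ℝ) ^ 2) μ := by
    simp only [sq_inner_eq_sum]
    exact integrable_finsetSum _ fun j _ => integrable_finsetSum _ fun k _ =>
      (hi4 j k).const_mul _
  have hi5 := integrable_cexp_inner μ ξ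
  have h1 : ∫ y, taylorQuot ξ y ∂(rescaled μ t) = (∫ y, taylorRem ξ y ∂μ) / (t : ℂ) := by
    have := integral_rescaled μ ht (taylorQuotBCF ξ)
    have e : ∀ y, taylorQuotBCF ξ y = taylorQuot ξ y := fun y => rfl
    simp only [e, taylorQuot_mul_gaussGap, taylorQuot_zero, add_zero] at this
    exact this
  have h2 : ∫ y, taylorRem ξ y ∂μ = charFun μ ξ - 1
      - Complex.I * (inner ℝ ξ (∫ y, softTrunc y ∂μ) : ℝ)
      + (1 / 2 : ℂ) * ((ξ.ofLp ⬝ᵥ secondMoments μ *ᵥ ξ.ofLp : ℝ) : ℂ) := by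
    have e : ∀ y : E d, taylorRem ξ y = Complex.exp ((inner ℝ y ξ : ℝ) * Complex.I) - 1
        - Complex.I * ((inner ℝ ξ (softTrunc y) : ℝ) : ℂ)
        + (1 / 2 : ℂ) * (((inner ℝ ξ (softTrunc y) : ℝ) ^ 2 : ℝ) : ℂ) := fun y => by
      rw [taylorRem, mul_comm Complex.I ((inner ℝ y ξ : ℝ) : ℂ)]
      push_cast
      ring
    simp only [e]
    have hi6 : Integrable (fun y : E d => Complex.exp ((inner ℝ y ξ : ℝ) * Complex.I) - 1) μ :=
      hi5.sub (integrable_const _)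
    have hi7 : Integrable (fun y : E d => Complex.I * ((inner ℝ ξ (softTrunc y) : ℝ) : ℂ)) μ :=
      hi2.ofReal.const_mul _
    have hi8 : Integrable (fun y : E d => Complex.exp ((inner ℝ y ξ : ℝ) * Complex.I) - 1
        - Complex.I * ((inner ℝ ξ (softTrunc y) : ℝ) : ℂ)) μ := hi6.sub hi7
    have hi9 : Integrable
        (fun y : E d => (1 / 2 : ℂ) * (((inner ℝ ξ (softTrunc y) : ℝ) ^ 2 : ℝ) : ℂ)) μ :=
      hi3.ofReal.const_mul _
    rw [integral_add hi8 hi9, integral_sub hi6 hi7,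
      integral_sub hi5 (integrable_const _), integral_const_mul,
      integral_const_mul, integral_complex_ofReal, integral_complex_ofReal,
      integral_sq_inner_softTrunc hi4, integral_inner hi1, charFun_apply]
    simp
  rw [h1, h2, real_inner_smul_right, Matrix.smul_mulVec, dotProduct_smul, smul_eq_mul]
  push_cast
  ring

theorem IsCharacteristicExponent.exists_triplet (hψ : IsCharacteristicExponent X P ψ)
    (hX : IsLevyProcess X P) :
    ∃ (l : E d) (Q : Matrix (Fin d) (Fin d) ℝ) (ν : Measure (E d)),
      IsLevyTriplet l Q ν ∧ ∀ ξ, ψ ξ = levyKhintchine l Q ν ξ := by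
  obtain ⟨t, ht⟩ := exists_seq_tendsto (𝓝[>] (0 : ℝ≥0))
  have hprob := fun n => hX.isProbabilityMeasure_map (t n)
  set μ : ℕ → Measure (E d) := fun n => P.map (X (t n)) with hμ
  have hprob' : ∀ n, IsProbabilityMeasure (μ n) := hprob
  set f : E d → ℂ := fun η => -ψ η - (∫ ξ, -ψ (η + ξ) ∂(stdGaussian (E d))) + 1 with hf
  have hlim : ∀ η, Tendsto (fun n => charFun (rescaled (μ n) (t n)) η) atTop (𝓝 (f η)) :=
    fun η => (hψ.tendsto_charFun_rescaled hX η).comp ht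
  -- The unit mass at the origin keeps all total masses at least `1`, even for the zero process.
  have hf0 : f 0 ≠ 0 := by
    have h1 : (1 : ℝ) ≤ (f 0).re := by
      refine ge_of_tendsto' ((Complex.continuous_re.tendsto _).comp (hlim 0)) fun n => ?_
      have h2 : (1 : ENNReal) ≤ rescaled (μ n) (t n) Set.univ := by
        rw [rescaled, Measure.add_apply, measure_univ (μ := Measure.dirac (0 : E d))]
        exact le_add_self
      simp only [Function.comp_apply, charFun_zero, Complex.ofReal_re, Measure.real]
      simpa using ENNReal.toReal_mono (measure_ne_top _ _) h2
    intro h0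
    rw [h0] at h1
    norm_num at h1
  obtain ⟨U, ρ, hU, hUle, hρfin, hρ⟩ := exists_weak_limit
    (ρ := fun n => rescaled (μ n) (t n)) (fun n => rescaled_ne_zero _ _)
    (hψ.continuous_gaussian_average hX) hf0 hlim
  -- Neither form is known to be bounded separately, but their combination converges. One is purely
  -- imaginary and the other real, so taking imaginary and real parts separates them.
  have hT : ∀ ξ : E d, Tendsto (fun n => Complex.I *
      (inner ℝ ξ ((t n : ℝ)⁻¹ • ∫ y, softTrunc y ∂(μ n)) : ℝ) - (1 / 2 : ℂ)
        * ((ξ.ofLp ⬝ᵥ ((t n : ℝ)⁻¹ • secondMoments (μ n)) *ᵥ ξ.ofLp : ℝ) : ℂ)) U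
      (𝓝 (-ψ ξ - ∫ y, taylorQuot ξ y ∂ρ)) := by
    intro ξ
    refine ((((hψ.tendsto_charFun hX ξ).comp ht).mono_left hUle).sub (hρ (taylorQuotBCF ξ))).congr
      fun n => ?_
    have := charFun_sub_one_div_eq (μ n) (t n).coe_nonneg ξ
    simp only [Function.comp_apply]
    rw [sub_eq_iff_eq_add]
    exact this
  have hmul : ∀ x : ℝ, Complex.I * (x : ℂ) = ⟨0, x⟩ := fun x => by
    apply Complex.ext <;> simp
  have hhalf : ∀ x : ℝ, (1 / 2 : ℂ) * (x : ℂ) = ((1 / 2 * x : ℝ) : ℂ) := fun x => by push_cast; ring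
  obtain ⟨l', hl'⟩ := exists_inner_of_tendsto (U := U)
    (l := fun n => (t n : ℝ)⁻¹ • ∫ y, softTrunc y ∂(μ n))
    (A := fun ξ => (-ψ ξ - ∫ y, taylorQuot ξ y ∂ρ).im) fun ξ => by
    refine ((Complex.continuous_im.tendsto _).comp (hT ξ)).congr fun n => ?_
    simp only [Function.comp_apply, Complex.sub_im, hmul, hhalf, Complex.ofReal_im, sub_zero]
  obtain ⟨Q', hQ's, hQ'⟩ := exists_matrix_of_tendsto (U := U)
    (q := fun n => (t n : ℝ)⁻¹ • secondMoments (μ n))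
    (fun n => (isSymm_secondMoments _).smul _)
    (B := fun ξ => -2 * (-ψ ξ - ∫ y, taylorQuot ξ y ∂ρ).re) fun ξ => by
    refine (((Complex.continuous_re.tendsto _).comp (hT ξ)).const_mul (-2)).congr fun n => ?_
    simp only [Function.comp_apply, Complex.sub_re, hmul, hhalf, Complex.ofReal_re]
    ring
  have hν := isLevyMeasure_unweighted ρ
  set ν := unweighted ρ with hνdef
  -- The drift absorbs the change of truncation. The limit matrix `Q'` still contains the second
  -- moments of the small jumps, which are subtracted.
  have hmain : ∀ ξ, ψ ξ = levyKhintchine (l' + ∫ y, (trunc y • y - softTrunc y) ∂ν)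
      (Q' - secondMoments ν) ν ξ := by
    intro ξ
    have h1 : -ψ ξ - ∫ y, taylorQuot ξ y ∂ρ = Complex.I * (inner ℝ ξ l' : ℝ)
        - (1 / 2 : ℂ) * ((ξ.ofLp ⬝ᵥ Q' *ᵥ ξ.ofLp : ℝ) : ℂ) := by
      rw [← hl', ← hQ', hmul, hhalf]
      apply Complex.ext
      · simp only [Complex.sub_re, Complex.ofReal_re]; ring
      · simp only [Complex.sub_im, Complex.ofReal_im]; ring
    rw [← integral_unweighted, integral_taylorRem hν] at h1
    rw [levyKhintchine, inner_add_left, Matrix.sub_mulVec, dotProduct_sub,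
      real_inner_comm ξ l', real_inner_comm ξ]
    push_cast
    linear_combination -h1
  exact ⟨_, _, ν, ⟨posSemidef_of_re_levyKhintchine_nonneg hν _ (hQ's.sub (isSymm_secondMoments ν))
    fun ξ => (hmain ξ) ▸ hψ.re_nonneg hX ξ, hν⟩, hmain⟩

end Existence

/-! ### Fourier representation of test functions -/

section Fourier

open scoped FourierTransform SchwartzMap LineDeriv

variable {d : ℕ}

/-- The Fourier transform `(2π)^{-d} ∫ U(x) exp(-i ξ·x) dx` of a Schwartz function. -/
noncomputable def schwartzHat (U : 𝓢(E d, ℂ)) (ξ : E d) : ℂ :=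
  (((2 * Real.pi) ^ d)⁻¹ : ℝ) * ∫ x : E d, U x * Complex.exp (-(Complex.I * (inner ℝ ξ x : ℝ)))

/-- Conversion from the `exp(-i ξ·x)` convention to that of `𝓕`, whose kernel is `exp(-2πi ⟨x, η⟩)`.
-/
theorem schwartzHat_eq (U : 𝓢(E d, ℂ)) (ξ : E d) :
    schwartzHat U ξ = (((2 * Real.pi) ^ d)⁻¹ : ℝ) * 𝓕 U ((2 * Real.pi)⁻¹ • ξ) := by
  rw [schwartzHat, SchwartzMap.fourier_coe, Real.fourier_eq']
  congr 1
  refine integral_congr_ae (.of_forall fun x => ?_)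
  simp only
  rw [smul_eq_mul, mul_comm]
  congr 2
  rw [real_inner_smul_right, real_inner_comm]
  have : -2 * Real.pi * ((2 * Real.pi)⁻¹ * (inner ℝ x ξ : ℝ)) = -(inner ℝ x ξ : ℝ) := by
    have := Real.pi_ne_zero
    field_simp
  rw [this]
  push_cast
  ring

theorem continuous_schwartzHat (U : 𝓢(E d, ℂ)) : Continuous (schwartzHat U) := by
  have : schwartzHat U = fun ξ => ((((2 * Real.pi) ^ d)⁻¹ : ℝ) : ℂ) * 𝓕 U ((2 * Real.pi)⁻¹ • ξ) :=
    funext (schwartzHat_eq U)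
  rw [this]
  exact continuous_const.mul ((𝓕 U).continuous.comp (by fun_prop))

theorem integrable_schwartzHat (U : 𝓢(E d, ℂ)) :
    Integrable (fun ξ => (1 + ‖ξ‖ ^ 2) * ‖schwartzHat U ξ‖) := by
  have hk : ∀ k : ℕ, Integrable (fun ξ : E d => ‖ξ‖ ^ k * ‖𝓕 U ((2 * Real.pi)⁻¹ • ξ)‖) := by
    intro k
    have h := (((𝓕 U).integrable_pow_mul (volume : Measure (E d)) k).comp_smul
      (inv_ne_zero Real.two_pi_pos.ne')).const_mul ((2 * Real.pi) ^ k)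
    have hp : (2 * Real.pi) ^ k * (2 * Real.pi)⁻¹ ^ k = 1 := by
      rw [← mul_pow, mul_inv_cancel₀ Real.two_pi_pos.ne', one_pow]
    refine h.congr (.of_forall fun ξ => ?_)
    simp only
    rw [norm_smul, Real.norm_of_nonneg (inv_nonneg.mpr Real.two_pi_pos.le), mul_pow _ ‖ξ‖]
    linear_combination (‖ξ‖ ^ k * ‖𝓕 U ((2 * Real.pi)⁻¹ • ξ)‖) * hp
  refine (((hk 0).add (hk 2)).const_mul ((2 * Real.pi) ^ d)⁻¹).congr (.of_forall fun ξ => ?_)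
  simp only [Pi.add_apply, pow_zero]
  rw [schwartzHat_eq, norm_mul, Complex.norm_real, Real.norm_of_nonneg (by positivity)]
  ring

theorem integrable_schwartzHat_mul (U : 𝓢(E d, ℂ)) {g : E d → ℂ}
    (hg : AEStronglyMeasurable g volume) (C : ℝ) (h : ∀ ξ, ‖g ξ‖ ≤ C * (1 + ‖ξ‖ ^ 2)) :
    Integrable (fun ξ => schwartzHat U ξ * g ξ) := by
  refine ((integrable_schwartzHat U).const_mul C).mono'
    ((continuous_schwartzHat U).aestronglyMeasurable.mul hg) (.of_forall fun ξ => ?_)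
  rw [norm_mul]
  calc _ ≤ ‖schwartzHat U ξ‖ * (C * (1 + ‖ξ‖ ^ 2)) := by gcongr; exact h ξ
    _ = _ := by ring

theorem norm_cexp_I_mul (θ : ℝ) : ‖Complex.exp (Complex.I * θ)‖ = 1 := by
  rw [mul_comm, Complex.norm_exp_ofReal_mul_I]

theorem integral_schwartzHat_mul_cexp (U : 𝓢(E d, ℂ)) (x : E d) :
    ∫ ξ, schwartzHat U ξ * Complex.exp (Complex.I * (inner ℝ x ξ : ℝ)) = U x := by
  have h2 : U x = 𝓕⁻ (𝓕 U) x := by rw [FourierTransform.fourierInv_fourier_eq]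
  rw [h2, SchwartzMap.fourierInv_coe, Real.fourierInv_eq']
  have h3 := Measure.integral_comp_inv_smul (volume : Measure (E d))
    (fun η => Complex.exp ((2 * Real.pi * (inner ℝ η x : ℝ) : ℝ) * Complex.I) • 𝓕 U η) (2 * Real.pi)
  have h4 : ∀ ξ : E d, schwartzHat U ξ * Complex.exp (Complex.I * (inner ℝ x ξ : ℝ))
      = ((((2 * Real.pi) ^ d)⁻¹ : ℝ) : ℂ) *
        (Complex.exp ((2 * Real.pi * (inner ℝ ((2 * Real.pi)⁻¹ • ξ) x : ℝ) : ℝ) * Complex.I)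
          • 𝓕 U ((2 * Real.pi)⁻¹ • ξ)) := by
    intro ξ
    rw [schwartzHat_eq, real_inner_smul_left, ← mul_assoc (2 * Real.pi),
      mul_inv_cancel₀ Real.two_pi_pos.ne', one_mul, real_inner_comm, smul_eq_mul,
      mul_comm Complex.I]
    ring
  simp_rw [h4]
  rw [integral_const_mul, h3, finrank_euclideanSpace_fin, abs_of_pos (by positivity),
    Complex.real_smul, ← mul_assoc, ← Complex.ofReal_mul, inv_mul_cancel₀ (by positivity)]
  simp

theorem schwartzHat_lineDerivOp (U : 𝓢(E d, ℂ)) (m ξ : E d) :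
    schwartzHat (∂_{m} U) ξ = Complex.I * (inner ℝ ξ m : ℝ) * schwartzHat U ξ := by
  have ht : (inner ℝ · m : E d → ℝ).HasTemperateGrowth := ((innerSL ℝ).flip m).hasTemperateGrowth
  rw [schwartzHat_eq, schwartzHat_eq, SchwartzMap.fourier_lineDerivOp_eq, smul_apply,
    SchwartzMap.smulLeftCLM_apply_apply ht, real_inner_smul_left]
  simp only [smul_eq_mul, Complex.real_smul]
  push_cast
  have : (Real.pi : ℂ) ≠ 0 := by exact_mod_cast Real.pi_ne_zero
  field_simp

/-- A real test function as a complex Schwartz function. -/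
noncomputable def IsTest.toSchwartz {f : E d → ℝ} (hf : IsTest f) : 𝓢(E d, ℂ) :=
  HasCompactSupport.toSchwartzMap (f := fun x => (f x : ℂ)) (hf.2.comp_left Complex.ofReal_zero)
    (Complex.ofRealCLM.contDiff.comp hf.1)

theorem IsTest.toSchwartz_apply {f : E d → ℝ} (hf : IsTest f) (x : E d) :
    hf.toSchwartz x = (f x : ℂ) := rfl

theorem IsTest.fourierHat_eq {f : E d → ℝ} (hf : IsTest f) (ξ : E d) :
    fourierHat f ξ = schwartzHat hf.toSchwartz ξ := rfl

theorem IsTest.fderiv {f : E d → ℝ} (hf : IsTest f) (m : E d) :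
    IsTest fun x => fderiv ℝ f x m :=
  ⟨(hf.1.fderiv_right (m := ∞) (by norm_num)).clm_apply contDiff_const, hf.2.fderiv_apply ℝ m⟩

theorem IsTest.lineDerivOp_toSchwartz {f : E d → ℝ} (hf : IsTest f) (m : E d) :
    ∂_{m} hf.toSchwartz = (hf.fderiv m).toSchwartz := by
  ext x
  rw [SchwartzMap.lineDerivOp_apply_eq_fderiv, IsTest.toSchwartz_apply]
  have hd : HasFDerivAt f (_root_.fderiv ℝ f x) x :=
    (hf.1.differentiable (by norm_num) x).hasFDerivAt
  have h : HasFDerivAt (fun x => (f x : ℂ)) (Complex.ofRealCLM.comp (_root_.fderiv ℝ f x)) x :=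
    Complex.ofRealCLM.hasFDerivAt.comp x hd
  have h' : _root_.fderiv ℝ (hf.toSchwartz : E d → ℂ) x = _ := h.fderiv
  rw [h']
  simp

theorem IsTest.fourierHat_fderiv {f : E d → ℝ} (hf : IsTest f) (m ξ : E d) :
    fourierHat (fun x => _root_.fderiv ℝ f x m) ξ
      = Complex.I * (inner ℝ ξ m : ℝ) * fourierHat f ξ := by
  rw [(hf.fderiv m).fourierHat_eq, ← hf.lineDerivOp_toSchwartz, schwartzHat_lineDerivOp,
    hf.fourierHat_eq]

theorem IsTest.continuous_fourierHat {f : E d → ℝ} (hf : IsTest f) : Continuous (fourierHat f) :=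
  continuous_schwartzHat hf.toSchwartz

theorem IsTest.integrable_fourierHat {f : E d → ℝ} (hf : IsTest f) :
    Integrable (fun ξ => (1 + ‖ξ‖ ^ 2) * ‖fourierHat f ξ‖) :=
  integrable_schwartzHat hf.toSchwartz

theorem IsTest.integrable_pdoIntegrand {f : E d → ℝ} (hf : IsTest f) {p : E d → ℂ}
    (hp : Continuous p) (C : ℝ) (h : ∀ ξ, ‖p ξ‖ ≤ C * (1 + ‖ξ‖ ^ 2)) (x : E d) :
    Integrable (pdoIntegrand (fun _ ξ => p ξ) f x) := by
  have h1 := integrable_schwartzHat_mul hf.toSchwartz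
    (g := fun ξ => p ξ * Complex.exp (Complex.I * (inner ℝ x ξ : ℝ)))
    (Continuous.aestronglyMeasurable (by fun_prop)) C fun ξ => by
      rw [norm_mul, norm_cexp_I_mul, mul_one]; exact h ξ
  refine h1.congr (.of_forall fun ξ => ?_)
  simp only [pdoIntegrand]
  rw [hf.fourierHat_eq, mul_assoc]

theorem IsTest.integrable_fourierHat_mul_cexp {f : E d → ℝ} (hf : IsTest f) (x : E d) :
    Integrable fun ξ => fourierHat f ξ * Complex.exp (Complex.I * (inner ℝ x ξ : ℝ)) :=
  integrable_schwartzHat_mul hf.toSchwartz (Continuous.aestronglyMeasurable (by fun_prop)) 1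
    fun ξ => by rw [norm_cexp_I_mul]; nlinarith [sq_nonneg ‖ξ‖]

theorem IsTest.integral_fourierHat_mul_cexp {f : E d → ℝ} (hf : IsTest f) (x : E d) :
    ∫ ξ, fourierHat f ξ * Complex.exp (Complex.I * (inner ℝ x ξ : ℝ)) = f x :=
  integral_schwartzHat_mul_cexp hf.toSchwartz x

theorem inner_gradient {f : E d → ℝ} (x y : E d) :
    (inner ℝ (gradient f x) y : ℝ) = fderiv ℝ f x y := by
  rw [gradient, InnerProductSpace.toDual_symm_apply]

theorem divergence_eq {f : E d → ℝ} (hf : IsTest f) (Q : Matrix (Fin d) (Fin d) ℝ) (x : E d) :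
    divergence (fun z => Q *ᵥ (gradient f z).ofLp) x
      = ∑ k, ∑ j, Q k j * fderiv ℝ (fun z => fderiv ℝ f z (EuclideanSpace.single j 1)) x
          (EuclideanSpace.single k 1) := by
  unfold divergence
  refine Finset.sum_congr rfl fun k _ => ?_
  have h1 : (fun z => (Q *ᵥ (gradient f z).ofLp) k)
      = fun z => ∑ j, Q k j * fderiv ℝ f z (EuclideanSpace.single j 1) := by
    funext z
    simp only [Matrix.mulVec, dotProduct]
    refine Finset.sum_congr rfl fun j _ => ?_
    rw [← inner_gradient, EuclideanSpace.inner_single_right]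
    simp
  have hdiff : ∀ j : Fin d, DifferentiableAt ℝ
      (fun z => fderiv ℝ f z (EuclideanSpace.single j 1)) x :=
    fun j => (hf.fderiv _).1.differentiable (by norm_num) x
  rw [h1, fderiv_fun_sum fun j _ => (hdiff j).const_mul _, sum_apply]
  refine Finset.sum_congr rfl fun j _ => ?_
  rw [fderiv_const_mul (hdiff j)]
  rfl

theorem integral_fourierHat_mul_inner {f : E d → ℝ} (hf : IsTest f) (m x : E d) :
    ∫ ξ, fourierHat f ξ * (Complex.I * (inner ℝ ξ m : ℝ))
      * Complex.exp (Complex.I * (inner ℝ x ξ : ℝ)) = fderiv ℝ f x m := by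
  rw [← (hf.fderiv m).integral_fourierHat_mul_cexp x]
  refine integral_congr_ae (.of_forall fun ξ => ?_)
  simp only
  rw [hf.fourierHat_fderiv]
  ring

theorem integrable_fourierHat_mul_inner {f : E d → ℝ} (hf : IsTest f) (m x : E d) :
    Integrable fun ξ => fourierHat f ξ * (Complex.I * (inner ℝ ξ m : ℝ))
      * Complex.exp (Complex.I * (inner ℝ x ξ : ℝ)) := by
  refine ((hf.fderiv m).integrable_fourierHat_mul_cexp x).congr (.of_forall fun ξ => ?_)
  simp only
  rw [hf.fourierHat_fderiv]
  ring

/-- Each product `ξ_k ξ_j` stands for two derivatives, whence the sign from `i² = -1`. -/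
theorem integral_fourierHat_mul_quadratic {f : E d → ℝ} (hf : IsTest f)
    (Q : Matrix (Fin d) (Fin d) ℝ) (x : E d) :
    Integrable (fun ξ : E d => fourierHat f ξ * ((ξ.ofLp ⬝ᵥ Q *ᵥ ξ.ofLp : ℝ) : ℂ)
      * Complex.exp (Complex.I * (inner ℝ x ξ : ℝ))) ∧
    ∫ ξ : E d, fourierHat f ξ * ((ξ.ofLp ⬝ᵥ Q *ᵥ ξ.ofLp : ℝ) : ℂ)
      * Complex.exp (Complex.I * (inner ℝ x ξ : ℝ))
      = -((divergence (fun z => Q *ᵥ (gradient f z).ofLp) x : ℝ) : ℂ) := by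
  set e : Fin d → E d := fun j => EuclideanSpace.single j 1 with he
  have hpt : ∀ ξ : E d, fourierHat f ξ * ((ξ.ofLp ⬝ᵥ Q *ᵥ ξ.ofLp : ℝ) : ℂ)
      * Complex.exp (Complex.I * (inner ℝ x ξ : ℝ))
      = ∑ k, ∑ j, (-(Q k j) : ℂ) * (fourierHat (fun z => fderiv ℝ f z (e j)) ξ
          * (Complex.I * (inner ℝ ξ (e k) : ℝ)) * Complex.exp (Complex.I * (inner ℝ x ξ : ℝ))) := by
    intro ξ
    rw [dotProduct_mulVec_eq_sum]
    push_cast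
    simp only [Finset.mul_sum, Finset.sum_mul]
    refine Finset.sum_congr rfl fun k _ => Finset.sum_congr rfl fun j _ => ?_
    rw [hf.fourierHat_fderiv, he, EuclideanSpace.inner_single_right,
      EuclideanSpace.inner_single_right]
    simp only [conj_trivial, one_mul]
    linear_combination (fourierHat f ξ * ξ k * ξ j * Q k j
      * Complex.exp (Complex.I * (inner ℝ x ξ : ℝ))) * Complex.I_sq
  have hi : ∀ k j, Integrable fun ξ : E d => (-(Q k j) : ℂ)
      * (fourierHat (fun z => fderiv ℝ f z (e j)) ξ
          * (Complex.I * (inner ℝ ξ (e k) : ℝ)) * Complex.exp (Complex.I * (inner ℝ x ξ : ℝ))) :=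
    fun k j => (integrable_fourierHat_mul_inner (hf.fderiv (e j)) (e k) x).const_mul _
  simp only [hpt]
  refine ⟨integrable_finsetSum _ fun k _ => integrable_finsetSum _ fun j _ => hi k j, ?_⟩
  rw [integral_finsetSum _ fun k _ => integrable_finsetSum _ fun j _ => hi k j, divergence_eq hf]
  push_cast
  rw [← Finset.sum_neg_distrib]
  refine Finset.sum_congr rfl fun k _ => ?_
  rw [integral_finsetSum _ fun j _ => hi k j, ← Finset.sum_neg_distrib]
  refine Finset.sum_congr rfl fun j _ => ?_
  rw [integral_const_mul, integral_fourierHat_mul_inner (hf.fderiv (e j))]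
  ring

/-- For fixed `y`, the factor `exp(iy·ξ)` is translation by `y` and `iξ·y` is the directional
derivative, so this is Fourier inversion term by term. -/
theorem integral_fourierHat_mul_lkIntegrand {f : E d → ℝ} (hf : IsTest f) (x y : E d) :
    ∫ ξ, fourierHat f ξ * lkIntegrand ξ y * Complex.exp (Complex.I * (inner ℝ x ξ : ℝ))
      = -((jumpIntegrand f x y : ℝ) : ℂ) := by
  have e : ∀ ξ : E d, fourierHat f ξ * lkIntegrand ξ y * Complex.exp (Complex.I * (inner ℝ x ξ : ℝ))
      = fourierHat f ξ * Complex.exp (Complex.I * (inner ℝ x ξ : ℝ))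
        - fourierHat f ξ * Complex.exp (Complex.I * (inner ℝ (x + y) ξ : ℝ))
        + (trunc y : ℂ) * (fourierHat f ξ * (Complex.I * (inner ℝ ξ y : ℝ))
          * Complex.exp (Complex.I * (inner ℝ x ξ : ℝ))) := by
    intro ξ
    rw [lkIntegrand, inner_add_left]
    push_cast
    rw [mul_add Complex.I, Complex.exp_add]
    ring
  have h1 := hf.integrable_fourierHat_mul_cexp x
  have h2 := hf.integrable_fourierHat_mul_cexp (x + y)
  have h3 := (integrable_fourierHat_mul_inner hf y x).const_mul (trunc y : ℂ)
  have h12 : Integrable fun ξ : E d =>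
      fourierHat f ξ * Complex.exp (Complex.I * (inner ℝ x ξ : ℝ))
        - fourierHat f ξ * Complex.exp (Complex.I * (inner ℝ (x + y) ξ : ℝ)) := h1.sub h2
  simp only [e]
  rw [integral_add h12 h3, integral_sub h1 h2, integral_const_mul,
    hf.integral_fourierHat_mul_cexp, hf.integral_fourierHat_mul_cexp,
    integral_fourierHat_mul_inner hf, jumpIntegrand, inner_gradient]
  push_cast
  ring

theorem integrable_prod_fourierHat_lkIntegrand {f : E d → ℝ} (hf : IsTest f) {ν : Measure (E d)}
    (hν : IsLevyMeasure ν) (x : E d) :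
    haveI := hν.sFinite
    Integrable (fun p : E d × E d => fourierHat f p.1 * lkIntegrand p.1 p.2
      * Complex.exp (Complex.I * (inner ℝ x p.1 : ℝ))) (volume.prod ν) := by
  have := hν.sFinite
  have hm : Measurable (fun p : E d × E d => fourierHat f p.1 * lkIntegrand p.1 p.2
      * Complex.exp (Complex.I * (inner ℝ x p.1 : ℝ))) := by
    have h1 : Measurable (fourierHat f) := hf.continuous_fourierHat.measurable
    have h2 : Measurable fun p : E d × E d => lkIntegrand p.1 p.2 := measurable_uncurry_lkIntegrand
    have h3 : Measurable fun p : E d × E d => Complex.exp (Complex.I * (inner ℝ x p.1 : ℝ)) :=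
      Continuous.measurable (by fun_prop)
    exact ((h1.comp measurable_fst).mul h2).mul h3
  refine ((hf.integrable_fourierHat.mul_prod hν.integrable_weight).const_mul 3).mono'
    hm.aestronglyMeasurable (.of_forall fun p => ?_)
  rw [norm_mul, norm_mul, norm_cexp_I_mul, mul_one]
  calc _ ≤ ‖fourierHat f p.1‖ * (3 * (1 + ‖p.1‖ ^ 2) * min 1 (‖p.2‖ ^ 2)) := by
        gcongr; exact norm_lkIntegrand_le _ _
    _ = _ := by ring

/-- Up to sign, the jump integrand is an inner integral of a function integrable on the product
space, so Fubini replaces a Taylor estimate for `f`. -/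
theorem IsTest.integrable_jumpIntegrand {f : E d → ℝ} (hf : IsTest f) {ν : Measure (E d)}
    (hν : IsLevyMeasure ν) (x : E d) : Integrable (jumpIntegrand f x) ν := by
  have := hν.sFinite
  have h := (integrable_prod_fourierHat_lkIntegrand hf hν x).integral_prod_right
  simp only [integral_fourierHat_mul_lkIntegrand hf] at h
  have h2 := h.re.neg
  refine h2.congr (.of_forall fun y => ?_)
  simp

/-- The integro-differential operator is the pseudo differential operator whose symbol is given
by the Lévy–Khintchine formula. -/
theorem IsTest.levyOperator_eq {f : E d → ℝ} (hf : IsTest f) {ν : Measure (E d)}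
    (hν : IsLevyMeasure ν) (l : E d) (Q : Matrix (Fin d) (Fin d) ℝ) (x : E d) :
    ((levyOperator l Q ν f x : ℝ) : ℂ)
      = -pseudoDiff (fun _ ξ => levyKhintchine l Q ν ξ) f x := by
  have := hν.sFinite
  have hprod := integrable_prod_fourierHat_lkIntegrand hf hν x
  obtain ⟨hQi, hQ⟩ := integral_fourierHat_mul_quadratic hf Q x
  have hli := integrable_fourierHat_mul_inner hf l x
  have hJi : Integrable fun ξ : E d => fourierHat f ξ * (∫ y, lkIntegrand ξ y ∂ν)
      * Complex.exp (Complex.I * (inner ℝ x ξ : ℝ)) := by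
    have := hprod.integral_prod_left
    simp only [integral_mul_const, integral_const_mul] at this
    exact this
  have hJ : ∫ ξ : E d, fourierHat f ξ * (∫ y, lkIntegrand ξ y ∂ν)
      * Complex.exp (Complex.I * (inner ℝ x ξ : ℝ)) = -((∫ y, jumpIntegrand f x y ∂ν : ℝ) : ℂ) := by
    have h := integral_integral_swap (f := fun ξ y => fourierHat f ξ * lkIntegrand ξ y
      * Complex.exp (Complex.I * (inner ℝ x ξ : ℝ))) hprod
    simp only [integral_mul_const, integral_const_mul,
      integral_fourierHat_mul_lkIntegrand hf] at h
    rw [h, integral_neg, integral_complex_ofReal]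
  have e : ∀ ξ : E d, pdoIntegrand (fun _ ξ => levyKhintchine l Q ν ξ) f x ξ
      = -(fourierHat f ξ * (Complex.I * (inner ℝ ξ l : ℝ))
          * Complex.exp (Complex.I * (inner ℝ x ξ : ℝ)))
        + (1 / 2 : ℂ) * (fourierHat f ξ * ((ξ.ofLp ⬝ᵥ Q *ᵥ ξ.ofLp : ℝ) : ℂ)
          * Complex.exp (Complex.I * (inner ℝ x ξ : ℝ)))
        + fourierHat f ξ * (∫ y, lkIntegrand ξ y ∂ν)
          * Complex.exp (Complex.I * (inner ℝ x ξ : ℝ)) := by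
    intro ξ
    rw [pdoIntegrand, levyKhintchine, real_inner_comm l ξ]
    ring
  have hln : Integrable fun ξ : E d => -(fourierHat f ξ * (Complex.I * (inner ℝ ξ l : ℝ))
          * Complex.exp (Complex.I * (inner ℝ x ξ : ℝ))) := hli.neg
  have hlQ : Integrable fun ξ : E d => -(fourierHat f ξ * (Complex.I * (inner ℝ ξ l : ℝ))
          * Complex.exp (Complex.I * (inner ℝ x ξ : ℝ)))
        + (1 / 2 : ℂ) * (fourierHat f ξ * ((ξ.ofLp ⬝ᵥ Q *ᵥ ξ.ofLp : ℝ) : ℂ)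
          * Complex.exp (Complex.I * (inner ℝ x ξ : ℝ))) := hln.add (hQi.const_mul _)
  rw [pseudoDiff]
  simp only [e]
  rw [integral_add hlQ hJi, integral_add hln (hQi.const_mul _), integral_neg,
    integral_const_mul, hJ, hQ, integral_fourierHat_mul_inner hf, levyOperator, real_inner_comm,
    inner_gradient]
  push_cast
  ring

end Fourier

/-! ### The generator on test functions -/

section Generator

open scoped FourierTransform

variable {d : ℕ}

theorem fourier_eq_integral_cexp (f : E d → ℂ) (η : E d) :
    𝓕 f η = ∫ ξ, f ξ * Complex.exp (Complex.I * (inner ℝ (-(2 * Real.pi) • η) ξ : ℝ)) := by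
  rw [Real.fourier_eq']
  refine integral_congr_ae (.of_forall fun ξ => ?_)
  simp only
  rw [smul_eq_mul, mul_comm]
  congr 2
  rw [real_inner_smul_left, real_inner_comm]
  push_cast
  ring

/-- The Riemann-Lebesgue lemma. -/
theorem tendsto_integral_cexp_cocompact (f : E d → ℂ) :
    Tendsto (fun x : E d => ∫ ξ, f ξ * Complex.exp (Complex.I * (inner ℝ x ξ : ℝ)))
      (cocompact (E d)) (𝓝 0) := by
  have h := tendsto_integral_exp_inner_smul_cocompact f
  have hne : (-(2 * Real.pi)⁻¹ : ℝ) ≠ 0 := neg_ne_zero.mpr (inv_ne_zero Real.two_pi_pos.ne')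
  have hc : Tendsto (fun x : E d => (-(2 * Real.pi)⁻¹ : ℝ) • x) (cocompact (E d))
      (cocompact (E d)) := (Homeomorph.smulOfNeZero _ hne).isClosedEmbedding.tendsto_cocompact
  refine (h.comp hc).congr fun x => ?_
  have e : (-(2 * Real.pi)) • ((-(2 * Real.pi)⁻¹ : ℝ) • x) = x := by
    rw [smul_smul, neg_mul_neg, mul_inv_cancel₀ Real.two_pi_pos.ne', one_smul]
  have h2 := fourier_eq_integral_cexp f ((-(2 * Real.pi)⁻¹ : ℝ) • x)
  rw [e] at h2
  rw [← h2]
  rfl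

theorem continuous_integral_cexp {f : E d → ℂ} (hf : Integrable f) :
    Continuous (fun x : E d => ∫ ξ, f ξ * Complex.exp (Complex.I * (inner ℝ x ξ : ℝ))) := by
  refine continuous_of_dominated (bound := fun ξ => ‖f ξ‖) (fun x => ?_)
    (fun x => .of_forall fun ξ => ?_) hf.norm (.of_forall fun ξ => by fun_prop)
  · exact hf.aestronglyMeasurable.mul (Continuous.aestronglyMeasurable (by fun_prop))
  · rw [norm_mul, norm_cexp_I_mul, mul_one]

/-- Injectivity of the Fourier transform. -/
theorem eq_zero_of_integral_cexp_eq_zero {f : E d → ℂ} (hc : Continuous f) (hf : Integrable f)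
    (h : ∀ x : E d, ∫ ξ, f ξ * Complex.exp (Complex.I * (inner ℝ x ξ : ℝ)) = 0) : f = 0 := by
  have h1 : 𝓕 f = 0 := by
    funext η
    rw [fourier_eq_integral_cexp, h]
    rfl
  have h2 := hc.fourierInv_fourier_eq hf (by rw [h1]; exact integrable_zero _ _ _)
  rw [← h2, h1]
  funext x
  rw [Real.fourierInv_eq']
  simp

variable {Ω : Type*} [MeasurableSpace Ω] {P : Measure Ω} [IsProbabilityMeasure P]
  {X : ℝ≥0 → Ω → E d} {ψ : E d → ℂ}

/-- Fourier inversion of `u` under the expectation, then Fubini. -/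
theorem semigroup_eq_integral {u : E d → ℝ} (hu : IsTest u) (hX : IsLevyProcess X P) (t : ℝ≥0)
    (x : E d) :
    ((semigroup X P t u x : ℝ) : ℂ) = ∫ ξ, fourierHat u ξ * charFun (P.map (X t)) ξ
      * Complex.exp (Complex.I * (inner ℝ x ξ : ℝ)) := by
  have hmt := hX.measurable t
  have hm : Measurable (fun p : E d × Ω => fourierHat u p.1
      * Complex.exp (Complex.I * (inner ℝ (X t p.2 + x) p.1 : ℝ))) := by
    have h1 : Measurable (fourierHat u) := hu.continuous_fourierHat.measurable
    have h2 : Measurable fun p : E d × Ω => (inner ℝ (X t p.2 + x) p.1 : ℝ) :=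
      ((hmt.comp measurable_snd).add_const x).inner measurable_fst
    fun_prop
  have hi : Integrable (fun p : E d × Ω => fourierHat u p.1
      * Complex.exp (Complex.I * (inner ℝ (X t p.2 + x) p.1 : ℝ))) (volume.prod P) := by
    refine (hu.integrable_fourierHat.mul_prod (integrable_const (1 : ℝ) (μ := P))).mono'
      hm.aestronglyMeasurable (.of_forall fun p => ?_)
    rw [norm_mul, norm_cexp_I_mul, mul_one, mul_one]
    nlinarith [mul_nonneg (sq_nonneg ‖p.1‖) (norm_nonneg (fourierHat u p.1))]
  have hs := integral_integral_swap (f := fun (ξ : E d) (w : Ω) => fourierHat u ξ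
      * Complex.exp (Complex.I * (inner ℝ (X t w + x) ξ : ℝ))) hi
  rw [semigroup, ← integral_complex_ofReal]
  simp only [hu.integral_fourierHat_mul_cexp] at hs
  rw [← hs]
  refine integral_congr_ae (.of_forall fun ξ => ?_)
  simp only
  rw [integral_const_mul, hX.charFun_eq, mul_assoc, ← integral_mul_const]
  congr 1
  refine integral_congr_ae (.of_forall fun w => ?_)
  simp only
  rw [← Complex.exp_add, inner_add_left, real_inner_comm ξ]
  push_cast
  ring_nf

/-- The difference quotient of the semigroup converges to `-ψ(D) u`, uniformly. -/
theorem IsCharacteristicExponent.exists_uniform_bound (hψ : IsCharacteristicExponent X P ψ)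
    (hX : IsLevyProcess X P) {u : E d → ℝ} (hu : IsTest u) :
    ∃ D : ℝ≥0 → ℝ, Tendsto D (𝓝[>] 0) (𝓝 0) ∧ ∀ t x,
      ‖(((semigroup X P t u x - u x) / (t : ℝ) : ℝ) : ℂ) - -pseudoDiff (fun _ ξ => ψ ξ) u x‖
        ≤ D t := by
  obtain ⟨C, hC0, hC⟩ := hψ.exists_norm_le hX
  have hψc := hψ.1
  have hF := hu.continuous_fourierHat
  have hcc : ∀ t, Continuous (charFun (P.map (X t))) := fun t => by
    have := hX.isProbabilityMeasure_map t
    exact continuous_charFun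
  have hbound : ∀ t ξ, ‖(charFun (P.map (X t)) ξ - 1) / ((t : ℝ) : ℂ) + ψ ξ‖
      ≤ 2 * C * (1 + ‖ξ‖ ^ 2) := by
    intro t ξ
    have h1 := hψ.norm_charFun_sub_one_div_le hX t ξ
    have h2 := hC ξ
    refine (norm_add_le _ _).trans ?_
    linarith
  have hbound' : ∀ t ξ, ‖‖fourierHat u ξ‖ * ‖(charFun (P.map (X t)) ξ - 1) / ((t : ℝ) : ℂ) + ψ ξ‖‖
      ≤ 2 * C * ((1 + ‖ξ‖ ^ 2) * ‖fourierHat u ξ‖) := by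
    intro t ξ
    rw [norm_mul, norm_norm, norm_norm]
    calc _ ≤ ‖fourierHat u ξ‖ * (2 * C * (1 + ‖ξ‖ ^ 2)) := by gcongr; exact hbound t ξ
      _ = _ := by ring
  have hmeas : ∀ t : ℝ≥0, AEStronglyMeasurable (fun ξ =>
      ‖fourierHat u ξ‖ * ‖(charFun (P.map (X t)) ξ - 1) / ((t : ℝ) : ℂ) + ψ ξ‖) volume := by
    intro t
    have := hcc t
    exact Continuous.aestronglyMeasurable (by fun_prop)
  -- The `L¹` norm of the error in Fourier space bounds the error at every `x`, hence uniformity. At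
  -- `t = 0` both quotients are `0`, so the bound needs no positivity of `t`.
  refine ⟨fun t => ∫ ξ, ‖fourierHat u ξ‖ * ‖(charFun (P.map (X t)) ξ - 1) / ((t : ℝ) : ℂ) + ψ ξ‖,
    ?_, fun t x => ?_⟩
  · have h := tendsto_integral_filter_of_dominated_convergence (l := 𝓝[>] (0 : ℝ≥0))
      (F := fun (t : ℝ≥0) ξ =>
        ‖fourierHat u ξ‖ * ‖(charFun (P.map (X t)) ξ - 1) / ((t : ℝ) : ℂ) + ψ ξ‖)
      (f := fun _ => 0) (fun ξ => 2 * C * ((1 + ‖ξ‖ ^ 2) * ‖fourierHat u ξ‖))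
      (.of_forall hmeas) (.of_forall fun t => .of_forall (hbound' t))
      (hu.integrable_fourierHat.const_mul _) (.of_forall fun ξ => by
        have h1 := (((hψ.tendsto_charFun hX ξ).add_const (ψ ξ)).norm).const_mul ‖fourierHat u ξ‖
        simpa using h1)
    simpa using h
  · have hi0 := hu.integrable_fourierHat_mul_cexp x
    have hiψ := hu.integrable_pdoIntegrand hψc C hC x
    have hiφ : Integrable fun ξ => fourierHat u ξ * charFun (P.map (X t)) ξ
        * Complex.exp (Complex.I * (inner ℝ x ξ : ℝ)) :=
      hu.integrable_pdoIntegrand (hcc t) 1 (fun ξ => by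
        have := hX.isProbabilityMeasure_map t
        exact (norm_charFun_le_one ξ).trans (by nlinarith [sq_nonneg ‖ξ‖])) x
    have e : (((semigroup X P t u x - u x) / (t : ℝ) : ℝ) : ℂ) - -pseudoDiff (fun _ ξ => ψ ξ) u x
        = ∫ ξ, fourierHat u ξ * ((charFun (P.map (X t)) ξ - 1) / ((t : ℝ) : ℂ) + ψ ξ)
          * Complex.exp (Complex.I * (inner ℝ x ξ : ℝ)) := by
      have hi1 : Integrable fun ξ => (fourierHat u ξ * charFun (P.map (X t)) ξ
          * Complex.exp (Complex.I * (inner ℝ x ξ : ℝ))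
          - fourierHat u ξ * Complex.exp (Complex.I * (inner ℝ x ξ : ℝ))) / ((t : ℝ) : ℂ) :=
        (hiφ.sub hi0).div_const _
      push_cast
      rw [semigroup_eq_integral hu hX, ← hu.integral_fourierHat_mul_cexp x, ← integral_sub hiφ hi0,
        ← integral_div, sub_neg_eq_add, pseudoDiff, ← integral_add hi1 hiψ]
      refine integral_congr_ae (.of_forall fun ξ => ?_)
      simp only [pdoIntegrand]
      ring
    rw [e]
    refine norm_integral_le_of_norm_le ((hu.integrable_fourierHat.const_mul (2 * C)).mono'
      (hmeas t) (.of_forall (hbound' t))) (.of_forall fun ξ => ?_)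
    rw [norm_mul, norm_mul, norm_cexp_I_mul, mul_one]

theorem IsCharacteristicExponent.generator_eq_pseudoDiff (hψ : IsCharacteristicExponent X P ψ)
    (hX : IsLevyProcess X P) (u : C₀(E d, ℝ)) (hu : IsTest u) :
    ∃ hD : u ∈ generatorDomain X P, ∀ x,
      ((generator X P ⟨u, hD⟩ x : ℝ) : ℂ) = -pseudoDiff (fun _ ξ => ψ ξ) u x := by
  obtain ⟨C, hC0, hC⟩ := hψ.exists_norm_le hX
  obtain ⟨D, hD0, hD⟩ := hψ.exists_uniform_bound hX hu
  have hi : Integrable fun ξ => fourierHat u ξ * ψ ξ :=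
    integrable_schwartzHat_mul hu.toSchwartz hψ.1.aestronglyMeasurable C hC
  -- Taking the real part gives a real-valued candidate; Riemann-Lebesgue gives decay at infinity.
  set g : C₀(E d, ℝ) :=
    { toFun := fun x => (-pseudoDiff (fun _ ξ => ψ ξ) u x).re
      continuous_toFun := Complex.continuous_re.comp (continuous_integral_cexp hi).neg
      zero_at_infty' := by
        have h := (tendsto_integral_cexp_cocompact fun ξ => fourierHat u ξ * ψ ξ).neg
        rw [neg_zero] at h
        exact (Complex.continuous_re.tendsto' 0 0 (by simp)).comp h } with hg
  have hgx : ∀ x, g x = (-pseudoDiff (fun _ ξ => ψ ξ) u x).re := fun x => rfl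
  have hlim : IsGeneratorLimit X P u g := by
    rw [IsGeneratorLimit, Metric.tendstoUniformly_iff]
    intro ε hε
    filter_upwards [hD0.eventually_lt_const hε] with t ht x
    refine lt_of_le_of_lt ?_ ht
    rw [dist_comm, Real.dist_eq, hgx]
    have h := (Complex.abs_re_le_norm _).trans (hD t x)
    rwa [Complex.sub_re, Complex.ofReal_re] at h
  have hmem : u ∈ generatorDomain X P := ⟨g, hlim⟩
  refine ⟨hmem, fun x => ?_⟩
  rw [generator_eq X P ⟨u, hmem⟩ g hlim, hgx]
  -- A limit of real difference quotients is real.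
  have him : (-pseudoDiff (fun _ ξ => ψ ξ) u x).im = 0 := by
    have h1 : ∀ t, |(-pseudoDiff (fun _ ξ => ψ ξ) u x).im| ≤ D t := fun t => by
      have h := (Complex.abs_im_le_norm _).trans (hD t x)
      rwa [Complex.sub_im, Complex.ofReal_im, zero_sub, abs_neg] at h
    exact abs_nonpos_iff.mp (ge_of_tendsto' hD0 h1)
  exact Complex.ext (by simp) (by rw [him]; simp)

/-! ### Uniqueness of the symbol -/

/-- A bump supported in radius `1/(1 + ‖ξ‖)` has `|ξ·x| ≤ 1 < π/2` on its support, so the cosine is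
positive there and the real part of the integral is positive. -/
theorem exists_isTest_fourierHat_ne_zero (ξ : E d) :
    ∃ u : C₀(E d, ℝ), IsTest u ∧ fourierHat u ξ ≠ 0 := by
  have hr : (0 : ℝ) < 1 / (1 + ‖ξ‖) := by positivity
  let b : ContDiffBump (0 : E d) := ⟨1 / (1 + ‖ξ‖) / 2, 1 / (1 + ‖ξ‖), by positivity, by linarith⟩
  have hb : IsTest (b : E d → ℝ) := ⟨b.contDiff, b.hasCompactSupport⟩
  refine ⟨⟨⟨b, b.continuous⟩, b.hasCompactSupport.is_zero_at_infty⟩, hb, fun h0 => ?_⟩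
  have h0' : fourierHat (b : E d → ℝ) ξ = 0 := h0
  rw [fourierHat, mul_eq_zero, or_iff_right (by
    exact_mod_cast inv_ne_zero (pow_ne_zero d Real.two_pi_pos.ne'))] at h0'
  have hcont : Continuous fun x : E d => b x * Real.cos (inner ℝ ξ x) :=
    b.continuous.mul (by fun_prop)
  have hpos : 0 < ∫ x : E d, b x * Real.cos (inner ℝ ξ x) := by
    refine hcont.integral_pos_of_hasCompactSupport_nonneg_nonzero
      (b.hasCompactSupport.mul_right) (fun x => ?_) (x := 0) ?_
    · by_cases hx : ‖x‖ < 1 / (1 + ‖ξ‖)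
      · refine mul_nonneg b.nonneg (Real.cos_nonneg_of_mem_Icc ?_)
        have h1 : |(inner ℝ ξ x : ℝ)| ≤ 1 := by
          refine (abs_real_inner_le_norm _ _).trans ?_
          calc ‖ξ‖ * ‖x‖ ≤ (1 + ‖ξ‖) * (1 / (1 + ‖ξ‖)) := by
                gcongr; linarith
            _ = 1 := by field_simp
        have h2 := abs_le.mp h1
        have h3 := Real.pi_gt_three
        constructor <;> linarith
      · have : b x = 0 := b.zero_of_le_dist (by rw [dist_zero_right]; exact not_lt.mp hx)
        simp [this]
    · rw [inner_zero_right, Real.cos_zero, mul_one]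
      exact (b.pos_of_mem_ball (Metric.mem_ball_self b.rOut_pos)).ne'
  have hre : (∫ x : E d, (b x : ℂ) * Complex.exp (-(Complex.I * (inner ℝ ξ x : ℝ)))).re
      = ∫ x : E d, b x * Real.cos (inner ℝ ξ x) := by
    have hi : Integrable fun x : E d => (b x : ℂ) * Complex.exp (-(Complex.I * (inner ℝ ξ x : ℝ))) := by
      refine Continuous.integrable_of_hasCompactSupport ?_ ?_
      · exact (Complex.continuous_ofReal.comp b.continuous).mul (by fun_prop)
      · exact (b.hasCompactSupport.comp_left (g := Complex.ofReal) Complex.ofReal_zero).mul_right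
    refine (integral_re hi).symm.trans (integral_congr_ae (.of_forall fun x => ?_))
    simp only
    have e : -(Complex.I * ((inner ℝ ξ x : ℝ) : ℂ)) = ((-(inner ℝ ξ x : ℝ) : ℝ) : ℂ) * Complex.I := by
      push_cast; ring
    rw [e]
    change ((b x : ℂ) * Complex.exp (((-(inner ℝ ξ x : ℝ) : ℝ) : ℂ) * Complex.I)).re = _
    rw [Complex.re_ofReal_mul, Complex.exp_ofReal_mul_I_re, Real.cos_neg]
  rw [h0'] at hre
  simp only [Complex.zero_re] at hre
  linarith

/-- The function `û(p - q)` is continuous and integrable with vanishing Fourier integral, hence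
identically zero; it is then evaluated at a point where `û` is nonzero. -/
theorem eq_of_pseudoDiff_eq {p q : E d → ℂ} (hp : Continuous p) (hq : Continuous q) (C : ℝ)
    (hpC : ∀ ξ, ‖p ξ‖ ≤ C * (1 + ‖ξ‖ ^ 2)) (C' : ℝ) (hqC : ∀ ξ, ‖q ξ‖ ≤ C' * (1 + ‖ξ‖ ^ 2))
    (h : ∀ u : C₀(E d, ℝ), IsTest u → ∀ x,
      pseudoDiff (fun _ ξ => p ξ) u x = pseudoDiff (fun _ ξ => q ξ) u x) (ξ : E d) : p ξ = q ξ := by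
  obtain ⟨u, hu, hne⟩ := exists_isTest_fourierHat_ne_zero ξ
  have hcont : Continuous fun η => fourierHat u η * (p η - q η) :=
    hu.continuous_fourierHat.mul (hp.sub hq)
  have hint : Integrable fun η => fourierHat u η * (p η - q η) :=
    integrable_schwartzHat_mul hu.toSchwartz (hp.sub hq).aestronglyMeasurable (C + C') fun η => by
      rw [add_mul]
      exact (norm_sub_le _ _).trans (add_le_add (hpC η) (hqC η))
  have h0 := eq_zero_of_integral_cexp_eq_zero hcont hint fun x => by
    have h1 := sub_eq_zero.mpr (h u hu x)
    rw [pseudoDiff, pseudoDiff, ← integral_sub (hu.integrable_pdoIntegrand hp C hpC x)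
      (hu.integrable_pdoIntegrand hq C' hqC x)] at h1
    rw [← h1]
    refine integral_congr_ae (.of_forall fun η => ?_)
    simp only [pdoIntegrand]
    ring
  have h2 := congrFun h0 ξ
  simp only [Pi.zero_apply, mul_eq_zero, hne, false_or] at h2
  exact sub_eq_zero.mp h2

end Generator

end LevyGen

/-! ### The generator and the Lévy-Khintchine formula -/

theorem theorem6p8 {Ω : Type*} [MeasurableSpace Ω] (P : Measure Ω) [IsProbabilityMeasure P]
    (d : ℕ) (X : ℝ≥0 → Ω → LevyGen.E d) (hX : LevyGen.IsLevyProcess X P) :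
    ∃ ψ : LevyGen.E d → ℂ, LevyGen.IsCharacteristicExponent X P ψ ∧
      -- every test function is in the domain, and the generator is `-ψ(D)` there
      (∀ u : C₀(LevyGen.E d, ℝ), LevyGen.IsTest u →
        ∃ hu : u ∈ LevyGen.generatorDomain X P, ∀ x : LevyGen.E d,
          Integrable (LevyGen.pdoIntegrand (fun _ ξ => ψ ξ) u x) ∧
          ((LevyGen.generator X P ⟨u, hu⟩ x : ℝ) : ℂ)
            = -LevyGen.pseudoDiff (fun _ ξ => ψ ξ) u x) ∧
      -- the integro-differential form and the Lévy–Khintchine formula, with a common triplet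
      (∃ (l : LevyGen.E d) (Q : Matrix (Fin d) (Fin d) ℝ) (ν : Measure (LevyGen.E d)),
        LevyGen.IsLevyTriplet l Q ν ∧
        (∀ f : C₀(LevyGen.E d, ℝ), LevyGen.IsTest f →
          ∃ hf : f ∈ LevyGen.generatorDomain X P, ∀ x : LevyGen.E d,
            Integrable (LevyGen.jumpIntegrand f x) ν ∧
            LevyGen.generator X P ⟨f, hf⟩ x = LevyGen.levyOperator l Q ν f x) ∧
        (∀ ξ : LevyGen.E d, Integrable (LevyGen.lkIntegrand ξ) ν ∧
          ψ ξ = LevyGen.levyKhintchine l Q ν ξ)) ∧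
      -- for any Lévy triplet the two representations are equivalent
      (∀ (l : LevyGen.E d) (Q : Matrix (Fin d) (Fin d) ℝ) (ν : Measure (LevyGen.E d)),
        LevyGen.IsLevyTriplet l Q ν →
        ((∀ f : C₀(LevyGen.E d, ℝ), LevyGen.IsTest f →
          ∃ hf : f ∈ LevyGen.generatorDomain X P, ∀ x : LevyGen.E d,
            LevyGen.generator X P ⟨f, hf⟩ x = LevyGen.levyOperator l Q ν f x) ↔
        (∀ ξ : LevyGen.E d, ψ ξ = LevyGen.levyKhintchine l Q ν ξ))) := by
  obtain ⟨ψ, hψ⟩ := hX.exists_isCharacteristicExponent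
  obtain ⟨C, -, hC⟩ := hψ.exists_norm_le hX
  have hgen := hψ.generator_eq_pseudoDiff hX
  -- Proved for an arbitrary triplet, so that it serves both the existence claim and one half of the
  -- equivalence.
  have hac : ∀ (l : LevyGen.E d) (Q : Matrix (Fin d) (Fin d) ℝ) (ν : Measure (LevyGen.E d)),
      LevyGen.IsLevyTriplet l Q ν → (∀ ξ, ψ ξ = LevyGen.levyKhintchine l Q ν ξ) →
      ∀ f : C₀(LevyGen.E d, ℝ), LevyGen.IsTest f →
        ∃ hf : f ∈ LevyGen.generatorDomain X P, ∀ x : LevyGen.E d,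
          LevyGen.generator X P ⟨f, hf⟩ x = LevyGen.levyOperator l Q ν f x := by
    intro l Q ν hT hψeq f hf
    obtain ⟨hD, h⟩ := hgen f hf
    refine ⟨hD, fun x => ?_⟩
    have h1 := h x
    rw [funext hψeq, ← hf.levyOperator_eq hT.levyMeasure] at h1
    exact_mod_cast h1
  refine ⟨ψ, hψ, fun u hu => ?_, ?_, fun l Q ν hT => ⟨fun h => ?_, hac l Q ν hT⟩⟩
  · obtain ⟨hD, h⟩ := hgen u hu
    exact ⟨hD, fun x => ⟨hu.integrable_pdoIntegrand hψ.1 C hC x, h x⟩⟩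
  · obtain ⟨l, Q, ν, hT, hψeq⟩ := hψ.exists_triplet hX
    refine ⟨l, Q, ν, hT, fun f hf => ?_, fun ξ => ⟨hT.levyMeasure.integrable_lkIntegrand ξ, hψeq ξ⟩⟩
    obtain ⟨hD, h⟩ := hac l Q ν hT hψeq f hf
    exact ⟨hD, fun x => ⟨hf.integrable_jumpIntegrand hT.levyMeasure x, h x⟩⟩
  -- Both symbols are continuous with quadratic growth and define the same operator on test
  -- functions, so they agree.
  · obtain ⟨C', -, hC'⟩ := hT.levyMeasure.exists_norm_levyKhintchine_le l Q
    refine LevyGen.eq_of_pseudoDiff_eq hψ.1 (hT.levyMeasure.continuous_levyKhintchine l Q) C hC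
      C' hC' fun u hu x => ?_
    obtain ⟨hD, h1⟩ := h u hu
    obtain ⟨hD', h2⟩ := hgen u hu
    have h3 := h2 x
    rw [h1 x, hu.levyOperator_eq hT.levyMeasure] at h3
    exact (neg_inj.mp h3).symm
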